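/- The stack-sorting map $s$ acts on orderings of finite sets of positive integers: it fixes the empty word, and if $\pi=LmR$ is nonempty with largest entry $m$, then $s(\pi)=s(L)\,s(R)\,m$. Let $w_n$ be the number of permutations $\pi\in S_n$ that are $3$-stack-sortable, i.e. such that $s^3(\pi)$ is increasing. There exists a unique series $Q(x,a)\equiv Q(t,x,a)$ in $\mathbb{Z}[a,x][[t]]$ that satisfies $$Q(x,a)=t(x+1)^2(1+a)^2+t(1+x)\,\frac{Q(x,a)-Q(x,0)}{a}\left((1+a)^2+a\,\frac{Q(x,a)-Q(0,a)}{x}\right)+t(1+x)\,a\,Q(x,a).$$ The generating function $$W(t)=\sum_{n=1}^{\infty}w_nt^n$$ of nonempty $3$-stack-sortable permutations is given by $W(t)=Q(t,0,0)$. -/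

import Mathlib

namespace StackSorting

/-- The stack-sorting map `s` on finite words: the empty word is fixed, and a nonempty word
`L m R` with largest entry `m` is sent to `s(L) s(R) m`. (Permutations are words without repeated
entries; on other words `m` is split off at its first occurrence.) -/
def stackSort : List ℕ → List ℕ
  | [] => []
  | h :: r =>
    stackSort ((h :: r).take ((h :: r).idxOf ((h :: r).max (List.cons_ne_nil h r)))) ++
      stackSort ((h :: r).drop ((h :: r).idxOf ((h :: r).max (List.cons_ne_nil h r)) + 1)) ++
      [(h :: r).max (List.cons_ne_nil h r)]
termination_by l => l.length
decreasing_by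
  · have := List.idxOf_lt_length_of_mem (List.max_mem (List.cons_ne_nil h r))
    rw [List.length_take]
    omega
  · rw [List.length_drop, List.length_cons]
    omega

theorem stackSort_nil : stackSort [] = [] := by
  rw [stackSort]

/-- The recursive description of the stack-sorting map. -/
theorem stackSort_append_cons (L R : List ℕ) (m : ℕ) (hL : ∀ y ∈ L, y < m) (hR : ∀ y ∈ R, y < m) :
    stackSort (L ++ m :: R) = stackSort L ++ stackSort R ++ [m] := by
  have key : ∀ l : List ℕ, l = L ++ m :: R →
      stackSort l = stackSort L ++ stackSort R ++ [m] := by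
    intro l hl
    cases l with
    | nil => simp at hl
    | cons h r =>
      have hmax : (h :: r).max (List.cons_ne_nil h r) = m := by
        apply le_antisymm
        · have h1 := List.max_mem (List.cons_ne_nil h r)
          generalize (h :: r).max (List.cons_ne_nil h r) = k at h1
          rw [hl] at h1
          rcases List.mem_append.1 h1 with h2 | h2
          · exact (hL _ h2).le
          · rcases List.mem_cons.1 h2 with h3 | h3
            · exact h3.le
            · exact (hR _ h3).le
        · apply List.le_max_of_mem
          rw [hl]
          simp
      have hm : m ∉ L := fun hmem => lt_irrefl _ (hL m hmem)
      have hidx : (h :: r).idxOf m = L.length := by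
        rw [hl, List.idxOf_append_of_notMem hm]
        simp
      rw [stackSort, hmax, hidx, hl]
      simp
  exact key _ rfl

/-- `sortable k n` is the set of `k`-stack-sortable permutations in `S_n`: the orderings `π` of
`1, …, n` (in one-line notation) such that the `k`-fold iterate `s^k(π)` is increasing. -/
def sortable (k n : ℕ) : Set (List ℕ) :=
  {π | π.Perm (List.range' 1 n) ∧ (stackSort^[k] π).Pairwise (· < ·)}

theorem sortable_finite (k n : ℕ) : (sortable k n).Finite :=
  (List.finite_toSet (List.range' 1 n).permutations).subset
    fun _ hπ => List.mem_permutations.2 hπ.1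

/-- The generating function `W(t) = ∑_{n ≥ 1} w_n tⁿ`, where `w_n` is the number of
`3`-stack-sortable permutations in `S_n`. -/
noncomputable def W : PowerSeries ℤ :=
  PowerSeries.mk fun n => if n = 0 then 0 else ((sortable 3 n).ncard : ℤ)

/-- The ring `ℤ[a, x][[t]]`, with `ℤ[a, x]` written as polynomials in `a` over `ℤ[x]`. -/
abbrev Ser : Type := PowerSeries (Polynomial (Polynomial ℤ))

/-- The variable `t`. -/
noncomputable def t : Ser := PowerSeries.X

/-- The variable `a`. -/
noncomputable def a : Ser := PowerSeries.C Polynomial.X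

/-- The variable `x`. -/
noncomputable def x : Ser := PowerSeries.C (Polynomial.C Polynomial.X)

/-- The substitution `Q(t, x, a) ↦ Q(t, x, 0)`. -/
noncomputable def setA : Ser →+* Ser :=
  PowerSeries.map (Polynomial.C.comp (Polynomial.evalRingHom 0))

/-- The substitution `Q(t, x, a) ↦ Q(t, 0, a)`. -/
noncomputable def setX : Ser →+* Ser :=
  PowerSeries.map (Polynomial.mapRingHom (Polynomial.C.comp (Polynomial.evalRingHom 0)))

/-- The substitution `Q(t, x, a) ↦ Q(t, 0, 0)`, with values in `ℤ[[t]]`. -/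
noncomputable def setBoth : Ser →+* PowerSeries ℤ :=
  PowerSeries.map ((Polynomial.evalRingHom 0).comp (Polynomial.evalRingHom 0))

/-- The functional equation
`Q(x,a) = t (x+1)² (1+a)²
  + t (1+x) (Q(x,a) - Q(x,0))/a * ((1+a)² + a (Q(x,a) - Q(0,a))/x) + t (1+x) a Q(x,a)`.
Here `D` is the quotient `(Q(x,a) - Q(x,0))/a` and `E` is the quotient `(Q(x,a) - Q(0,a))/x`;
both exist, and they are unique because `ℤ[a, x][[t]]` is a domain. -/
def FunctionalEquation (Q : Ser) : Prop :=
  ∃ D E : Ser, a * D = Q - setA Q ∧ x * E = Q - setX Q ∧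
    Q = t * (x + 1) ^ 2 * (1 + a) ^ 2 + t * (1 + x) * D * ((1 + a) ^ 2 + a * E)
      + t * (1 + x) * a * Q

end StackSorting

namespace StackSorting

/-! Write f(w) for the number of preimages of w under s. A permutation p is 3-stack-sortable exactly
when w = s(p) is 2-stack-sortable, so w_n is the sum of f(w) over the 2-stack-sortable w of length
n. This sum is refined by two catalytic statistics. The polynomial P_w(a) = `cutPoly w` sums
a^(number of cuts) times the product of the f(piece) over all cuttings of w into nonempty pieces;
P_w(0) = f(w). The number c(w) = `(cuts (stackSort w)).card` counts the places, both ends included,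
where s(w) splits into a lower part followed by a higher part. Then Q = ∑ t^|w| (1+x)^c(w) (1+a)²
P_w(a), and Q(0,0) = W.

The functional equation comes from removing the largest entry n of w = L n R. Two identities govern
P. If R is nonempty, a piece in which n is not last has no preimages, so a cut after n is forced and
P_{LnR} = a P_{Ln} P_R. If L is nonempty, a P_{Ln} = (1+a)² P_L - f(L), because f(Un) is the sum of
f(U₁) f(U₂) over all U = U₁U₂. The second identity says that P_{Ln} is the contribution of L to
(Q(x,a) - Q(x,0))/a.

For L and R nonempty, write s(L) = T m, so that s(w) = T m s(R) n. This is sorted by one more pass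
exactly when T and s(R) are, T lies below s(R), and s(R) = B₁B₂ with B₁ < m < B₂. Thus w amounts to
two smaller 2-stack-sortable words and one of the c(R) cuts of s(R) (`interleave_spec`,
`exists_interleave_eq`, `interleave_injective`). The chosen cut leaves c(w) = c(L) + 1 + (number of
later cuts), so summing over it turns (1+x)^c(R) into ((1+x)^c(R) - 1)/x, the quotient (Q(x,a) -
Q(0,a))/x. The cases L or R empty give the remaining terms.

Uniqueness holds since the right-hand side has a factor t. -/

/-! ### Elementary properties of the stack-sorting map. -/

theorem exists_eq_append_max {l : List ℕ} (hl : l ≠ []) (hd : l.Nodup) :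
    ∃ L m R, l = L ++ m :: R ∧ (∀ y ∈ L, y < m) ∧ (∀ y ∈ R, y < m) := by
  obtain ⟨L, R, h⟩ := List.append_of_mem (List.max_mem hl)
  have hle : ∀ y ∈ l, y ≤ l.max hl := fun y hy => List.le_max_of_mem hy
  generalize l.max hl = m at h hle
  subst h
  rw [List.nodup_middle, List.nodup_cons] at hd
  refine ⟨L, m, R, rfl, fun y hy => ?_, fun y hy => ?_⟩
  · refine lt_of_le_of_ne (hle y (by simp [hy])) ?_
    rintro rfl
    exact hd.1 (by simp [hy])
  · refine lt_of_le_of_ne (hle y (by simp [hy])) ?_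
    rintro rfl
    exact hd.1 (by simp [hy])

/-- Induction on a word without repeated entries by splitting off its largest entry. -/
theorem nodup_max_induction {motive : List ℕ → Prop} (nil : motive [])
    (step : ∀ L m R, (∀ y ∈ L, y < m) → (∀ y ∈ R, y < m) → motive L → motive R →
      motive (L ++ m :: R)) : ∀ l : List ℕ, l.Nodup → motive l := by
  intro l
  induction hn : l.length using Nat.strong_induction_on generalizing l with
  | _ n ih =>
    intro hd
    by_cases hl : l = []
    · rw [hl]; exact nil
    · obtain ⟨L, m, R, rfl, hL, hR⟩ := exists_eq_append_max hl hd
      subst hn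
      rw [List.nodup_middle, List.nodup_cons] at hd
      have h2 := List.nodup_append.1 hd.2
      refine step L m R hL hR (ih _ ?_ L rfl h2.1) (ih _ ?_ R rfl h2.2.1) <;>
        simp only [List.length_append, List.length_cons] <;> omega

theorem stackSort_perm (l : List ℕ) : (stackSort l).Perm l := by
  induction hn : l.length using Nat.strong_induction_on generalizing l with
  | _ n ih =>
    cases l with
    | nil => rw [stackSort_nil]
    | cons h r =>
      rw [stackSort]
      have hm := List.idxOf_lt_length_of_mem (List.max_mem (List.cons_ne_nil h r))
      have hget := List.getElem_idxOf hm
      generalize (h :: r).max (List.cons_ne_nil h r) = m at *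
      generalize (h :: r).idxOf m = k at *
      generalize h :: r = l at *
      have hl : l = l.take k ++ m :: l.drop (k + 1) := by
        rw [← hget, ← List.drop_eq_getElem_cons hm, List.take_append_drop]
      have h1 := ih _ (by rw [List.length_take]; omega) (l.take k) rfl
      have h2 := ih _ (by rw [List.length_drop]; omega) (l.drop (k + 1)) rfl
      conv_rhs => rw [hl]
      exact (List.perm_append_singleton _ _).trans
        (((h1.append h2).cons m).trans List.perm_middle.symm)

theorem stackSort_append_singleton (L : List ℕ) (m : ℕ) (hL : ∀ y ∈ L, y < m) :
    stackSort (L ++ [m]) = stackSort L ++ [m] := by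
  rw [stackSort_append_cons L [] m hL (by simp), stackSort_nil, List.append_nil]

theorem stackSort_cons (R : List ℕ) (m : ℕ) (hR : ∀ y ∈ R, y < m) :
    stackSort (m :: R) = stackSort R ++ [m] := by
  have h := stackSort_append_cons [] R m (by simp) hR
  rwa [stackSort_nil, List.nil_append, List.nil_append] at h

theorem mem_stackSort {l : List ℕ} {y : ℕ} : y ∈ stackSort l ↔ y ∈ l :=
  (stackSort_perm l).mem_iff

theorem stackSort_map {f : ℕ → ℕ} (hf : StrictMono f) (l : List ℕ) (hl : l.Nodup) :
    stackSort (l.map f) = (stackSort l).map f := by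
  refine nodup_max_induction (motive := fun l => stackSort (l.map f) = (stackSort l).map f)
    ?_ ?_ l hl
  · simp [stackSort_nil]
  · intro L m R hL hR ihL ihR
    rw [stackSort_append_cons L R m hL hR, List.map_append, List.map_cons,
      stackSort_append_cons, ihL, ihR]
    · simp
    · simpa using fun y hy => hf (hL y hy)
    · simpa using fun y hy => hf (hR y hy)

/-! ### Preimages and fertility. -/

/-- The set of preimages of a word under the stack-sorting map. -/
def preimages (w : List ℕ) : Finset (List ℕ) :=
  w.permutations.toFinset.filter fun p => stackSort p = w

theorem mem_preimages {w p : List ℕ} : p ∈ preimages w ↔ stackSort p = w := by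
  simp only [preimages, Finset.mem_filter, List.mem_toFinset, List.mem_permutations,
    and_iff_right_iff_imp]
  rintro rfl
  exact (stackSort_perm p).symm

/-- The fertility of a word: its number of preimages under the stack-sorting map. -/
def fertility (w : List ℕ) : ℕ := (preimages w).card

/-- The map puts the largest entry last, so nothing can follow m in an image; splitting p at its
only m gives L and R. -/
theorem exists_eq_append_of_stackSort_eq {p U V : List ℕ} {m : ℕ} (hU : ∀ y ∈ U, y < m)
    (hV : ∀ y ∈ V, y < m) (h : stackSort p = U ++ m :: V) :
    V = [] ∧ ∃ L R, p = L ++ m :: R ∧ (∀ y ∈ L, y < m) ∧ (∀ y ∈ R, y < m) ∧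
      stackSort L ++ stackSort R = U := by
  have hperm : (m :: (U ++ V)).Perm p :=
    (List.perm_middle.symm.trans (h ▸ List.Perm.refl _)).trans (stackSort_perm p)
  obtain ⟨L, R, rfl⟩ := List.append_of_mem (hperm.subset (List.mem_cons_self ..))
  have hlt : ∀ y ∈ L ++ R, y < m := fun y hy => by
    have := ((hperm.trans List.perm_middle).cons_inv).mem_iff.2 hy
    exact (List.mem_append.1 this).elim (hU y) (hV y)
  have hL : ∀ y ∈ L, y < m := fun y hy => hlt y (List.mem_append_left _ hy)
  have hR : ∀ y ∈ R, y < m := fun y hy => hlt y (List.mem_append_right _ hy)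
  rw [stackSort_append_cons L R m hL hR, List.append_cons_inj_of_notMem] at h
  · exact ⟨h.2.2.symm, L, R, rfl, hL, hR, h.1⟩
  · intro hm
    simp only [List.mem_append, mem_stackSort] at hm
    exact (hlt m (List.mem_append.2 hm)).false
  · exact List.not_mem_nil

theorem fertility_nil : fertility [] = 1 := by
  rw [fertility, Finset.card_eq_one]
  refine ⟨[], Finset.ext fun p => ?_⟩
  rw [mem_preimages, Finset.mem_singleton]
  refine ⟨fun h => ?_, fun h => by rw [h, stackSort_nil]⟩
  exact List.nil_perm.1 (h ▸ stackSort_perm p)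

theorem fertility_append_cons_eq_zero {U V : List ℕ} {m : ℕ} (hU : ∀ y ∈ U, y < m)
    (hV : ∀ y ∈ V, y < m) (hne : V ≠ []) : fertility (U ++ m :: V) = 0 := by
  rw [fertility, Finset.card_eq_zero, Finset.eq_empty_iff_forall_notMem]
  intro p hp
  exact hne (exists_eq_append_of_stackSort_eq hU hV (mem_preimages.1 hp)).1

/-- A preimage is L m R with s(L) s(R) = U. The index i is the length of s(L); both ends are
allowed, as L or R may be empty. -/
theorem fertility_append_singleton {U : List ℕ} {m : ℕ} (hU : ∀ y ∈ U, y < m) :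
    fertility (U ++ [m]) =
      ∑ i ∈ Finset.range (U.length + 1), fertility (U.take i) * fertility (U.drop i) := by
  have h1 : ∀ i, fertility (U.take i) * fertility (U.drop i) =
      (preimages (U.take i) ×ˢ preimages (U.drop i)).card := fun i => by
    rw [Finset.card_product, fertility, fertility]
  simp only [h1]
  rw [← Finset.card_sigma, fertility]
  symm
  refine Finset.card_bij (fun z _ => z.2.1 ++ m :: z.2.2) ?_ ?_ ?_
  · rintro ⟨i, L, R⟩ h
    simp only [Finset.mem_sigma, Finset.mem_product, mem_preimages] at h ⊢
    rw [stackSort_append_cons, h.2.1, h.2.2, List.take_append_drop]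
    · exact fun y hy => hU y (List.mem_of_mem_take (h.2.1 ▸ mem_stackSort.2 hy))
    · exact fun y hy => hU y (List.mem_of_mem_drop (h.2.2 ▸ mem_stackSort.2 hy))
  · rintro ⟨i, L, R⟩ h ⟨i', L', R'⟩ h' heq
    simp only [Finset.mem_sigma, Finset.mem_product, mem_preimages, Finset.mem_range] at h h'
    have key : ∀ j (A : List ℕ), stackSort A = U.take j → m ∉ A := fun j A hA hm =>
      (hU m (List.mem_of_mem_take (hA ▸ mem_stackSort.2 hm))).false
    dsimp only at heq
    obtain ⟨rfl, -, rfl⟩ := (List.append_cons_inj_of_notMem (key _ _ h.2.1) fun hm =>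
      (hU m (List.mem_of_mem_drop (h.2.2 ▸ mem_stackSort.2 hm))).false).1 heq
    have e := congrArg List.length (h.2.1.symm.trans h'.2.1)
    rw [List.length_take, List.length_take] at e
    obtain rfl : i = i' := by omega
    rfl
  · intro p hp
    obtain ⟨-, L, R, rfl, hL, hR, h⟩ :=
      exists_eq_append_of_stackSort_eq hU (by simp) (mem_preimages.1 hp)
    refine ⟨⟨(stackSort L).length, L, R⟩, ?_, rfl⟩
    subst h
    simp [mem_preimages]

theorem exists_perm_eq_map {f : ℕ → ℕ} (hf : Function.Injective f) {w l : List ℕ}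
    (h : w.Perm (l.map f)) : ∃ v : List ℕ, v.Perm l ∧ w = v.map f := by
  have hinv : ∀ y, Function.invFun f (f y) = y := Function.leftInverse_invFun hf
  refine ⟨w.map (Function.invFun f), ?_, ?_⟩
  · have := h.map (Function.invFun f)
    rw [List.map_map] at this
    simpa [Function.comp_def, hinv] using this
  · rw [List.map_map]
    symm
    refine (List.map_congr_left (g := id) fun y hy => ?_).trans (List.map_id w)
    obtain ⟨z, -, rfl⟩ := List.mem_map.1 (h.subset hy)
    simp [hinv]

/-- Sorting commutes with increasing relabelling, so fertility depends only on the relative order.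
-/
theorem fertility_map {f : ℕ → ℕ} (hf : StrictMono f) {w : List ℕ} (hw : w.Nodup) :
    fertility (w.map f) = fertility w := by
  have hinj : Function.Injective (List.map f) := List.map_injective_iff.2 hf.injective
  rw [fertility, fertility, ← Finset.card_image_of_injective (preimages w) hinj]
  congr 1
  ext p
  simp only [mem_preimages, Finset.mem_image]
  constructor
  · intro h
    obtain ⟨v, hv, rfl⟩ := exists_perm_eq_map hf.injective
      (h ▸ (stackSort_perm p).symm)
    refine ⟨v, hinj ?_, rfl⟩
    rw [← h, stackSort_map hf v (hv.nodup_iff.2 hw)]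
  · rintro ⟨v, rfl, rfl⟩
    exact stackSort_map hf v ((stackSort_perm v).nodup_iff.1 hw)

/-! ### Cutting polynomials. -/

open Polynomial

/-- The generating polynomial of the ways of cutting the word `p ++ r`, without cuts inside of
`p`, into nonempty pieces; a cut has weight `X`, and a piece the number of its preimages. -/
noncomputable def cutPolyAux : List ℕ → List ℕ → ℤ[X]
  | p, [] => (fertility p : ℤ[X])
  | p, h :: r => cutPolyAux (p ++ [h]) r + X * (fertility p : ℤ[X]) * cutPolyAux [h] r

/-- The generating polynomial of the ways of cutting a nonempty word into nonempty pieces; a cut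
has weight `X`, and a piece the number of its preimages. -/
noncomputable def cutPoly : List ℕ → ℤ[X]
  | [] => 0
  | h :: r => cutPolyAux [h] r

/-- In every cutting the first piece contains U m V, where the largest entry m is not last, so it
has no preimages. -/
theorem cutPolyAux_eq_zero {m : ℕ} : ∀ (r U V : List ℕ), (∀ y ∈ U, y < m) → (∀ y ∈ V, y < m) →
    (∀ y ∈ r, y < m) → V ≠ [] → cutPolyAux (U ++ m :: V) r = 0
  | [], U, V, hU, hV, _, hne => by
    rw [cutPolyAux, fertility_append_cons_eq_zero hU hV hne, Nat.cast_zero]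
  | h :: r, U, V, hU, hV, hr, hne => by
    rw [List.forall_mem_cons] at hr
    rw [cutPolyAux, fertility_append_cons_eq_zero hU hV hne, List.append_assoc, List.cons_append,
      cutPolyAux_eq_zero r U (V ++ [h]) hU ?_ hr.2 (by simp)]
    · simp
    · intro y hy
      rcases List.mem_append.1 hy with h1 | h1
      · exact hV y h1
      · rw [List.mem_singleton.1 h1]; exact hr.1

/-- Only cuttings with a cut directly after m survive; the factor X is that forced cut. -/
theorem cutPolyAux_append_cons {m h : ℕ} {r : List ℕ} (hr : ∀ y ∈ h :: r, y < m) :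
    ∀ L U : List ℕ, (∀ y ∈ U, y < m) → (∀ y ∈ L, y < m) →
      cutPolyAux U (L ++ m :: h :: r) = X * cutPolyAux U (L ++ [m]) * cutPolyAux [h] r
  | [], U, hU, _ => by
    have hr' := List.forall_mem_cons.1 hr
    have e1 : cutPolyAux (U ++ [m] ++ [h]) r = 0 := by
      rw [List.append_assoc, List.singleton_append]
      exact cutPolyAux_eq_zero r U [h] hU (by simpa using hr'.1) hr'.2 (by simp)
    have e2 : cutPolyAux ([m] ++ [h]) r = 0 :=
      cutPolyAux_eq_zero r [] [h] (by simp) (by simpa using hr'.1) hr'.2 (by simp)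
    simp only [List.nil_append, cutPolyAux, e1, e2]
    ring
  | k :: L, U, hU, hL => by
    rw [List.forall_mem_cons] at hL
    rw [List.cons_append, List.cons_append, cutPolyAux, cutPolyAux,
      cutPolyAux_append_cons hr L _ ?_ hL.2, cutPolyAux_append_cons hr L _ ?_ hL.2]
    · ring
    · simpa using hL.1
    · intro y hy
      rcases List.mem_append.1 hy with h1 | h1
      · exact hU y h1
      · rw [List.mem_singleton.1 h1]; exact hL.1

/-- In a cutting of U L m, the fertility of the last piece V m sums over splittings V = V₁V₂.
Dropping m leaves a cutting of U L: one new cut if V₁ and V₂ are nonempty, which yields every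
cutting except the uncut word; two choices of weight 2X if exactly one is empty; weight X² if both
are. The final sum corrects for splittings inside the prefix U, which `cutPolyAux` does not allow as
cuts. -/
theorem X_mul_cutPolyAux_append_singleton {m : ℕ} : ∀ L U : List ℕ, U ≠ [] → (∀ y ∈ U, y < m) →
    (∀ y ∈ L, y < m) →
    X * cutPolyAux U (L ++ [m]) = (1 + X) ^ 2 * cutPolyAux U L - (fertility (U ++ L) : ℤ[X]) +
      X * ∑ i ∈ Finset.Ico 1 U.length,
        (fertility (U.take i) : ℤ[X]) * (fertility (U.drop i ++ L) : ℤ[X])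
  | [], U, hne, hU, _ => by
    have hpos : 0 < U.length := List.length_pos_of_ne_nil hne
    have e0 : fertility [m] = 1 := by
      have := fertility_append_singleton (U := []) (m := m) (by simp)
      simpa [fertility_nil] using this
    simp only [List.nil_append, List.append_nil, cutPolyAux, fertility_append_singleton hU, e0]
    -- The splittings at the two ends of U give the 2X in (1 + X)²; the inner ones form the
    -- correction sum.
    rw [Finset.sum_range_succ, Finset.range_eq_Ico, Finset.sum_eq_sum_Ico_succ_bot hpos]
    simp only [List.take_zero, List.drop_zero, List.take_length, List.drop_length, fertility_nil]
    push_cast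
    ring
  | h :: L, U, hne, hU, hL => by
    rw [List.forall_mem_cons] at hL
    have hU' : ∀ y ∈ U ++ [h], y < m := by
      intro y hy
      rcases List.mem_append.1 hy with h1 | h1
      · exact hU y h1
      · rw [List.mem_singleton.1 h1]; exact hL.1
    have hpos : 0 < U.length := List.length_pos_of_ne_nil hne
    have i1 := X_mul_cutPolyAux_append_singleton L (U ++ [h]) (by simp) hU' hL.2
    have i2 := X_mul_cutPolyAux_append_singleton L [h] (by simp) (by simpa using hL.1) hL.2
    have e : ∑ i ∈ Finset.Ico 1 (U ++ [h]).length, (fertility ((U ++ [h]).take i) : ℤ[X]) *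
          (fertility ((U ++ [h]).drop i ++ L) : ℤ[X]) =
        ∑ i ∈ Finset.Ico 1 U.length, (fertility (U.take i) : ℤ[X]) *
          (fertility (U.drop i ++ h :: L) : ℤ[X]) + (fertility U : ℤ[X]) * fertility (h :: L) := by
      rw [List.length_append, List.length_singleton, Finset.sum_Ico_succ_top hpos]
      congr 1
      · refine Finset.sum_congr rfl fun i hi => ?_
        have hi' := (Finset.mem_Ico.1 hi).2.le
        rw [List.take_append_of_le_length hi', List.drop_append_of_le_length hi',
          List.append_assoc, List.singleton_append]
      · rw [List.take_left, List.drop_left, List.singleton_append]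
    rw [e] at i1
    simp only [List.length_singleton, Finset.Ico_self, Finset.sum_empty, List.append_assoc,
      List.singleton_append] at i1 i2
    rw [List.cons_append, cutPolyAux, cutPolyAux]
    linear_combination i1 + X * (fertility U : ℤ[X]) * i2

theorem cutPoly_singleton (m : ℕ) : cutPoly [m] = 1 := by
  have := fertility_append_singleton (U := []) (m := m) (by simp)
  simp only [cutPoly, cutPolyAux]
  simp only [List.nil_append] at this
  simp [this, fertility_nil]

theorem cutPoly_append_cons {m : ℕ} {L R : List ℕ} (hL : ∀ y ∈ L, y < m) (hR : ∀ y ∈ R, y < m)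
    (hne : R ≠ []) : cutPoly (L ++ m :: R) = X * cutPoly (L ++ [m]) * cutPoly R := by
  obtain ⟨h, r, rfl⟩ := List.exists_cons_of_ne_nil hne
  cases L with
  | nil =>
    have hR' := List.forall_mem_cons.1 hR
    have e : cutPolyAux ([m] ++ [h]) r = 0 :=
      cutPolyAux_eq_zero r [] [h] (by simp) (by simpa using hR'.1) hR'.2 (by simp)
    have e0 := cutPoly_singleton m
    rw [List.nil_append, List.nil_append, e0]
    simp only [cutPoly, cutPolyAux] at e0 ⊢
    rw [e, e0]
    ring
  | cons k L =>
    rw [List.forall_mem_cons] at hL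
    simp only [List.cons_append, cutPoly]
    exact cutPolyAux_append_cons hR L [k] (by simpa using hL.1) hL.2

/-- The case of a one-letter prefix, where the correction sum is empty. -/
theorem X_mul_cutPoly_append_singleton {m : ℕ} {L : List ℕ} (hL : ∀ y ∈ L, y < m)
    (hne : L ≠ []) :
    X * cutPoly (L ++ [m]) = (1 + X) ^ 2 * cutPoly L - (fertility L : ℤ[X]) := by
  obtain ⟨h, r, rfl⟩ := List.exists_cons_of_ne_nil hne
  rw [List.forall_mem_cons] at hL
  have := X_mul_cutPolyAux_append_singleton r [h] (by simp) (by simpa using hL.1) hL.2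
  simpa [cutPoly] using this

theorem eval_zero_cutPolyAux : ∀ r p : List ℕ,
    (cutPolyAux p r).eval 0 = (fertility (p ++ r) : ℤ)
  | [], p => by simp [cutPolyAux]
  | h :: r, p => by simp [cutPolyAux, eval_zero_cutPolyAux r (p ++ [h])]

theorem eval_zero_cutPoly {w : List ℕ} (hne : w ≠ []) :
    (cutPoly w).eval 0 = (fertility w : ℤ) := by
  obtain ⟨h, r, rfl⟩ := List.exists_cons_of_ne_nil hne
  rw [cutPoly, eval_zero_cutPolyAux, List.singleton_append]

theorem cutPolyAux_map {f : ℕ → ℕ} (hf : StrictMono f) : ∀ r p : List ℕ, (p ++ r).Nodup →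
    cutPolyAux (p.map f) (r.map f) = cutPolyAux p r
  | [], p, h => by
    rw [List.append_nil] at h
    rw [List.map_nil, cutPolyAux, cutPolyAux, fertility_map hf h]
  | k :: r, p, h => by
    have h1 : (p ++ [k] ++ r).Nodup := by simpa using h
    have i1 := cutPolyAux_map hf r (p ++ [k]) h1
    have i2 := cutPolyAux_map hf r [k] (List.nodup_append.1 h).2.1
    rw [List.map_append] at i1
    rw [List.map_singleton] at i1 i2
    rw [List.map_cons, cutPolyAux, cutPolyAux, i1, i2, fertility_map hf (List.nodup_append.1 h).1]

theorem cutPoly_map {f : ℕ → ℕ} (hf : StrictMono f) {w : List ℕ} (hw : w.Nodup) :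
    cutPoly (w.map f) = cutPoly w := by
  cases w with
  | nil => rfl
  | cons h r => exact cutPolyAux_map hf r [h] hw

/-! ### Cuts into a lower part and a higher part. -/

/-- The cutting positions of a word into two parts, such that every entry of the first part is
smaller than every entry of the second part. -/
def cuts (w : List ℕ) : Finset ℕ :=
  (Finset.range (w.length + 1)).filter fun j => ∀ u ∈ w.take j, ∀ v ∈ w.drop j, u < v

theorem mem_cuts {w : List ℕ} {j : ℕ} :
    j ∈ cuts w ↔ j ≤ w.length ∧ ∀ u ∈ w.take j, ∀ v ∈ w.drop j, u < v := by
  rw [cuts, Finset.mem_filter, Finset.mem_range, Nat.lt_succ_iff]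

theorem mem_cuts_append {w₁ w₂ : List ℕ} :
    w₁.length ∈ cuts (w₁ ++ w₂) ↔ ∀ u ∈ w₁, ∀ v ∈ w₂, u < v := by
  simp [mem_cuts]

theorem exists_append_of_mem_cuts {w : List ℕ} {j : ℕ} (h : j ∈ cuts w) :
    ∃ w₁ w₂, w = w₁ ++ w₂ ∧ w₁.length = j ∧ ∀ u ∈ w₁, ∀ v ∈ w₂, u < v := by
  rw [mem_cuts] at h
  exact ⟨w.take j, w.drop j, (List.take_append_drop j w).symm, by simp [h.1], h.2⟩

theorem cuts_map {f : ℕ → ℕ} (hf : StrictMono f) (w : List ℕ) : cuts (w.map f) = cuts w := by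
  ext j
  simp only [mem_cuts, List.length_map, ← List.map_take, ← List.map_drop, List.forall_mem_map,
    hf.lt_iff_lt]

/-- Up to the position before m, everything from m on exceeds A, so only A matters. Beyond m, the
cut cannot leave an entry of B₁ on the right, as it would be smaller than m. -/
theorem cuts_append_cons {A B₁ B₂ : List ℕ} {m : ℕ} (hA : ∀ u ∈ A, u < m)
    (hAB : ∀ u ∈ A, ∀ v ∈ B₁ ++ B₂, u < v) (h₁ : ∀ v ∈ B₁, v < m) (h₂ : ∀ v ∈ B₂, m < v) :
    cuts (A ++ m :: (B₁ ++ B₂)) = cuts A ∪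
      ((cuts (B₁ ++ B₂)).filter (B₁.length ≤ ·)).image (A.length + 1 + ·) := by
  ext k
  rw [Finset.mem_union, Finset.mem_image]
  rcases Nat.lt_or_ge A.length k with hk | hk
  · obtain ⟨i, rfl⟩ := Nat.exists_eq_add_of_lt hk
    have e1 : (A ++ m :: (B₁ ++ B₂)).take (A.length + i + 1) = A ++ m :: (B₁ ++ B₂).take i := by
      rw [Nat.add_assoc, List.take_length_add_append, List.take_succ_cons]
    have e2 : (A ++ m :: (B₁ ++ B₂)).drop (A.length + i + 1) = (B₁ ++ B₂).drop i := by
      rw [Nat.add_assoc, List.drop_length_add_append, List.drop_succ_cons]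
    have e3 : A.length + i + 1 ∉ cuts A := fun h => by
      have := (mem_cuts.1 h).1
      omega
    rw [or_iff_right e3]
    have e4 : (∃ c ∈ (cuts (B₁ ++ B₂)).filter (B₁.length ≤ ·),
        A.length + 1 + c = A.length + i + 1) ↔ i ∈ cuts (B₁ ++ B₂) ∧ B₁.length ≤ i := by
      constructor
      · rintro ⟨c, hc, he⟩
        obtain rfl : c = i := by omega
        simpa using hc
      · intro h
        exact ⟨i, by simpa using h, by omega⟩
    rw [e4, mem_cuts, mem_cuts, e1, e2]
    have hlen : A.length + i + 1 ≤ (A ++ m :: (B₁ ++ B₂)).length ↔ i ≤ (B₁ ++ B₂).length := by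
      simp only [List.length_append, List.length_cons]
      omega
    rw [hlen, and_assoc]
    refine and_congr_right fun _ => ?_
    constructor
    · intro h
      refine ⟨fun u hu => h u (by simp [hu]), ?_⟩
      by_contra hlt
      have hi : i < B₁.length := by omega
      have hmem : B₁[i] ∈ (B₁ ++ B₂).drop i := by
        rw [List.drop_append_of_le_length hi.le, List.drop_eq_getElem_cons hi]
        exact List.mem_cons_self ..
      exact lt_asymm (h m (by simp) _ hmem) (h₁ _ (List.getElem_mem hi))
    · rintro ⟨h, hle⟩ u hu v hv
      rcases List.mem_append.1 hu with hu | hu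
      · exact hAB u hu v (List.mem_of_mem_drop hv)
      · rcases List.mem_cons.1 hu with rfl | hu
        · apply h₂
          obtain ⟨d, rfl⟩ := Nat.exists_eq_add_of_le hle
          rw [List.drop_length_add_append] at hv
          exact List.mem_of_mem_drop hv
        · exact h u hu v hv
  · have e1 : (A ++ m :: (B₁ ++ B₂)).take k = A.take k := List.take_append_of_le_length hk
    have e2 : (A ++ m :: (B₁ ++ B₂)).drop k = A.drop k ++ m :: (B₁ ++ B₂) :=
      List.drop_append_of_le_length hk
    have e3 : ¬ ∃ c ∈ (cuts (B₁ ++ B₂)).filter (B₁.length ≤ ·), A.length + 1 + c = k := by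
      rintro ⟨c, -, he⟩
      omega
    rw [or_iff_left e3, mem_cuts, mem_cuts, e1, e2]
    refine and_congr (iff_of_true ?_ hk) ?_
    · simp only [List.length_append]
      omega
    · constructor
      · exact fun h u hu v hv => h u hu v (List.mem_append_left _ hv)
      · intro h u hu v hv
        have hu' := List.mem_of_mem_take hu
        rcases List.mem_append.1 hv with hv | hv
        · exact h u hu v hv
        · rcases List.mem_cons.1 hv with rfl | hv
          · exact hA u hu'
          · exact hAB u hu' v hv

theorem card_cuts_append_singleton {A : List ℕ} {m : ℕ} (hA : ∀ u ∈ A, u < m) :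
    (cuts (A ++ [m])).card = (cuts A).card + 1 := by
  have h := cuts_append_cons (B₁ := []) (B₂ := []) hA (by simp) (by simp) (by simp)
  have h0 : cuts [] = {0} := by
    ext j
    simp [mem_cuts]
  rw [List.append_nil] at h
  rw [h, h0, Finset.card_union_of_disjoint]
  · simp
  · rw [Finset.disjoint_left]
    intro k hk hk'
    have := (mem_cuts.1 hk).1
    simp at hk'
    omega

/-- The cut between B₁ and B₂ is counted as the final cut of A m, hence the strict inequality in the
filter. -/
theorem card_cuts_append_cons {A B₁ B₂ : List ℕ} {m : ℕ} (hA : ∀ u ∈ A, u < m)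
    (hAB : ∀ u ∈ A, ∀ v ∈ B₁ ++ B₂, u < v) (h₁ : ∀ v ∈ B₁, v < m) (h₂ : ∀ v ∈ B₂, m < v) :
    (cuts (A ++ m :: (B₁ ++ B₂))).card =
      (cuts (A ++ [m])).card + ((cuts (B₁ ++ B₂)).filter (B₁.length < ·)).card := by
  have hB : B₁.length ∈ cuts (B₁ ++ B₂) :=
    mem_cuts_append.2 fun u hu v hv => (h₁ u hu).trans (h₂ v hv)
  have e : (cuts (B₁ ++ B₂)).filter (B₁.length ≤ ·) =
      insert B₁.length ((cuts (B₁ ++ B₂)).filter (B₁.length < ·)) := by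
    ext k
    simp only [Finset.mem_filter, Finset.mem_insert]
    constructor
    · rintro ⟨hk, hle⟩
      exact hle.eq_or_lt.imp Eq.symm fun h => ⟨hk, h⟩
    · rintro (rfl | h)
      · exact ⟨hB, le_rfl⟩
      · exact ⟨h.1, h.2.le⟩
  rw [cuts_append_cons hA hAB h₁ h₂, Finset.card_union_of_disjoint,
    Finset.card_image_of_injective _ (add_right_injective _), e, Finset.card_insert_of_notMem,
    card_cuts_append_singleton hA]
  · omega
  · simp
  · rw [Finset.disjoint_left]
    intro k hk hk'
    have := (mem_cuts.1 hk).1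
    obtain ⟨c, -, rfl⟩ := Finset.mem_image.1 hk'
    omega

/-- The number of larger elements takes each value 0, …, |S| - 1 once on S. This produces the
geometric sum behind the divided difference in x. -/
theorem sum_pow_card_filter_lt {R : Type*} [CommSemiring R] (y : R) (S : Finset ℕ) :
    ∑ j ∈ S, y ^ (S.filter (j < ·)).card = ∑ i ∈ Finset.range S.card, y ^ i := by
  induction S using Finset.induction_on_min with
  | empty => simp
  | insert b S hb ih =>
    have hbS : b ∉ S := fun h => (hb b h).false
    rw [Finset.sum_insert hbS, Finset.card_insert_of_notMem hbS, Finset.sum_range_succ, ← ih,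
      add_comm]
    congr 1
    · refine Finset.sum_congr rfl fun j hj => ?_
      rw [Finset.filter_insert, if_neg (hb j hj).not_gt]
    · rw [Finset.filter_insert, if_neg (lt_irrefl b), Finset.filter_true_of_mem hb]

/-! ### Words sorted by one pass. -/

theorem stackSort_pairwise_lt_iff {L R : List ℕ} {m : ℕ} (hL : ∀ y ∈ L, y < m)
    (hR : ∀ y ∈ R, y < m) :
    (stackSort (L ++ m :: R)).Pairwise (· < ·) ↔ (stackSort L).Pairwise (· < ·) ∧
      (stackSort R).Pairwise (· < ·) ∧ ∀ u ∈ L, ∀ v ∈ R, u < v := by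
  rw [stackSort_append_cons L R m hL hR]
  simp only [List.pairwise_append, mem_stackSort, List.pairwise_singleton, true_and,
    List.mem_singleton, forall_eq, List.mem_append]
  constructor
  · exact fun h => h.1
  · exact fun h => ⟨h, fun y hy => hy.elim (hL y) (hR y)⟩

/-- Induction on B through its largest entry k. If k < m, then m is the maximum of the word and the
split is at m. If k > m, sortedness puts everything before k below everything after it, so B₂ takes
in k and the rest, and the induction goes on with the part before k. -/
theorem stackSort_append_cons_pairwise_lt_iff {A : List ℕ} {m : ℕ} (hA : ∀ u ∈ A, u < m) :
    ∀ B : List ℕ, (m :: B).Nodup → ((stackSort (A ++ m :: B)).Pairwise (· < ·) ↔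
      (stackSort A).Pairwise (· < ·) ∧ (stackSort B).Pairwise (· < ·) ∧
        (∀ u ∈ A, ∀ v ∈ B, u < v) ∧
        ∃ B₁ B₂, B = B₁ ++ B₂ ∧ (∀ v ∈ B₁, v < m) ∧ ∀ v ∈ B₂, m < v) := by
  intro B
  induction hn : B.length using Nat.strong_induction_on generalizing B with
  | _ n ih =>
    intro hB
    rw [List.nodup_cons] at hB
    by_cases hm : ∀ v ∈ B, v < m
    · rw [stackSort_pairwise_lt_iff hA hm]
      exact ⟨fun h => ⟨h.1, h.2.1, h.2.2, B, [], by simp, hm, by simp⟩,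
        fun h => ⟨h.1, h.2.1, h.2.2.1⟩⟩
    · have hne : B ≠ [] := by
        rintro rfl
        simp at hm
      obtain ⟨C, k, D, rfl, hC, hD⟩ := exists_eq_append_max hne hB.2
      have hmk : m < k := by
        by_contra hle
        have hle' : k < m := lt_of_le_of_ne (not_lt.1 hle) fun h => hB.1 (by simp [h])
        refine hm fun v hv => ?_
        rcases List.mem_append.1 hv with hv | hv
        · exact (hC v hv).trans hle'
        · rcases List.mem_cons.1 hv with rfl | hv
          · exact hle'
          · exact (hD v hv).trans hle'
      have hAC : ∀ y ∈ A ++ m :: C, y < k := by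
        intro y hy
        rcases List.mem_append.1 hy with hy | hy
        · exact (hA y hy).trans hmk
        · rcases List.mem_cons.1 hy with rfl | hy
          · exact hmk
          · exact hC y hy
      have hmC : (m :: C).Nodup :=
        List.nodup_cons.2 ⟨fun h => hB.1 (by simp [h]), (List.nodup_append.1 hB.2).1⟩
      have hlen : C.length < n := by
        rw [← hn, List.length_append, List.length_cons]
        omega
      have e : A ++ m :: (C ++ k :: D) = (A ++ m :: C) ++ k :: D := by simp
      rw [e, stackSort_pairwise_lt_iff hAC hD, ih C.length hlen C rfl hmC,
        stackSort_pairwise_lt_iff hC hD]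
      constructor
      · rintro ⟨⟨h1, h2, h3, B₁, B₂, rfl, h4, h5⟩, h6, h7⟩
        refine ⟨h1, ⟨h2, h6, fun u hu => h7 u ?_⟩, ?_, B₁, B₂ ++ k :: D, by simp, h4, ?_⟩
        · exact List.mem_append_right _ (List.mem_cons_of_mem _ hu)
        · intro u hu v hv
          rcases List.mem_append.1 hv with hv | hv
          · exact h3 u hu v hv
          · rcases List.mem_cons.1 hv with rfl | hv
            · exact (hA u hu).trans hmk
            · exact h7 u (List.mem_append_left _ hu) v hv
        · intro v hv
          rcases List.mem_append.1 hv with hv | hv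
          · exact h5 v hv
          · rcases List.mem_cons.1 hv with rfl | hv
            · exact hmk
            · exact h7 m (by simp) v hv
      · rintro ⟨h1, ⟨h2, h6, h7⟩, h3, B₁, B₂, h8, h4, h5⟩
        -- Since k > m, the block B₁ ends before k, so the given splitting of B restricts to C.
        have hkB₁ : k ∉ B₁ := fun h => lt_asymm hmk (h4 k h)
        obtain ⟨C', rfl, rfl⟩ : ∃ C', C = B₁ ++ C' ∧ B₂ = C' ++ k :: D := by
          rcases List.append_eq_append_iff.1 h8 with ⟨w, hw1, hw2⟩ | ⟨w, hw1, hw2⟩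
          · cases w with
            | nil => exact ⟨[], by simpa using hw1.symm, by simpa using hw2.symm⟩
            | cons z w =>
              rw [List.cons_append, List.cons.injEq] at hw2
              exact absurd (by rw [hw1, hw2.1]; simp) hkB₁
          · exact ⟨w, hw1, hw2⟩
        refine ⟨⟨h1, h2, ?_, B₁, C', rfl, h4, ?_⟩, h6, ?_⟩
        · exact fun u hu v hv => h3 u hu v (List.mem_append_left _ hv)
        · exact fun v hv => h5 v (List.mem_append_left _ hv)
        · intro u hu v hv
          rcases List.mem_append.1 hu with hu | hu
          · exact h3 u hu v (by simp [hv])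
          · rcases List.mem_cons.1 hu with rfl | hu
            · exact h5 v (by simp [hv])
            · exact h7 u hu v hv

/-- Sorting U and V separately and concatenating gives a sorted word, which must be the interval
itself. -/
theorem perm_range'_of_append {U V : List ℕ} {s : ℕ}
    (h : (U ++ V).Perm (List.range' s (U.length + V.length)))
    (hUV : ∀ u ∈ U, ∀ v ∈ V, u < v) :
    U.Perm (List.range' s U.length) ∧ V.Perm (List.range' (s + U.length) V.length) := by
  have pU := List.mergeSort_perm U (· ≤ ·)
  have pV := List.mergeSort_perm V (· ≤ ·)
  have sU : (U.mergeSort (· ≤ ·)).Pairwise (· ≤ ·) := List.pairwise_mergeSort' (· ≤ ·) U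
  have sV : (V.mergeSort (· ≤ ·)).Pairwise (· ≤ ·) := List.pairwise_mergeSort' (· ≤ ·) V
  have hs : (U.mergeSort (· ≤ ·) ++ V.mergeSort (· ≤ ·)).Pairwise (· ≤ ·) :=
    List.pairwise_append.2 ⟨sU, sV, fun u hu v hv =>
      (hUV u (pU.mem_iff.1 hu) v (pV.mem_iff.1 hv)).le⟩
  have hr : (List.range' s (U.length + V.length)).Pairwise (· ≤ ·) :=
    List.pairwise_le_range'
  have e := ((pU.append pV).trans h).eq_of_pairwise (fun _ _ _ _ => le_antisymm) hs hr
  rw [← List.range'_append_1] at e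
  obtain ⟨e1, e2⟩ := List.append_inj e (by rw [pU.length_eq, List.length_range'])
  exact ⟨pU.symm.trans (e1 ▸ List.Perm.refl _), pV.symm.trans (e2 ▸ List.Perm.refl _)⟩

/-! ### Decomposition of 2-stack-sortable permutations at the largest entry. -/

/-- The nonempty orderings `w` of `1, …, n` such that `s²(w)` is increasing. -/
def twoSortable (n : ℕ) : Finset (List ℕ) :=
  (List.range' 1 n).permutations.toFinset.filter fun w =>
    (stackSort (stackSort w)).Pairwise (· < ·) ∧ w ≠ []

theorem mem_twoSortable {n : ℕ} {w : List ℕ} : w ∈ twoSortable n ↔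
    w.Perm (List.range' 1 n) ∧ (stackSort (stackSort w)).Pairwise (· < ·) ∧ w ≠ [] := by
  rw [twoSortable, Finset.mem_filter, List.mem_toFinset, List.mem_permutations]

theorem lt_of_mem_twoSortable {n : ℕ} {w : List ℕ} (h : w ∈ twoSortable n) :
    ∀ y ∈ w, y < n + 1 := by
  intro y hy
  have := ((mem_twoSortable.1 h).1.mem_iff).1 hy
  rw [List.mem_range'_1] at this
  omega

theorem length_of_mem_twoSortable {n : ℕ} {w : List ℕ} (h : w ∈ twoSortable n) :
    w.length = n := by
  rw [(mem_twoSortable.1 h).1.length_eq, List.length_range']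

theorem nodup_of_mem_twoSortable {n : ℕ} {w : List ℕ} (h : w ∈ twoSortable n) : w.Nodup :=
  (mem_twoSortable.1 h).1.nodup_iff.2 List.nodup_range'

theorem exists_eq_append_cons_of_perm_range' {n : ℕ} {w : List ℕ}
    (h : w.Perm (List.range' 1 (n + 1))) :
    ∃ L R, w = L ++ (n + 1) :: R ∧ (∀ y ∈ L, y < n + 1) ∧ (∀ y ∈ R, y < n + 1) ∧
      (L ++ R).Perm (List.range' 1 n) := by
  rw [List.range'_1_concat, Nat.add_comm 1 n] at h
  obtain ⟨L, R, rfl⟩ := List.append_of_mem (h.symm.subset (by simp : n + 1 ∈ _))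
  have hp : (L ++ R).Perm (List.range' 1 n) :=
    (List.perm_middle.symm.trans (h.trans (List.perm_append_singleton _ _))).cons_inv
  have hlt : ∀ y ∈ L ++ R, y < n + 1 := fun y hy => by
    have := List.mem_range'_1.1 (hp.mem_iff.1 hy)
    omega
  exact ⟨L, R, rfl, fun y hy => hlt y (List.mem_append_left _ hy),
    fun y hy => hlt y (List.mem_append_right _ hy), hp⟩

/-- The increasing map that leaves `k` values free above `a`. -/
def shiftAbove (a k y : ℕ) : ℕ := if y ≤ a then y else y + k

theorem shiftAbove_strictMono (a k : ℕ) : StrictMono (shiftAbove a k) := by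
  intro y z h
  unfold shiftAbove
  split_ifs <;> omega

/-- The increasing map that skips the values up to `a` and then the value `a + k + 1`. -/
def shiftSkip (a k y : ℕ) : ℕ := if y ≤ k then y + a else y + a + 1

theorem shiftSkip_strictMono (a k : ℕ) : StrictMono (shiftSkip a k) := by
  intro y z h
  unfold shiftSkip
  split_ifs <;> omega

theorem map_shiftAbove_of_le {a k : ℕ} {w : List ℕ} (h : ∀ y ∈ w, y ≤ a) :
    w.map (shiftAbove a k) = w := by
  conv_rhs => rw [← List.map_id w]
  exact List.map_congr_left fun y hy => if_pos (h y hy)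

theorem map_shiftAbove_range' (a k : ℕ) :
    (List.range' 1 (a + 1)).map (shiftAbove a k) = List.range' 1 a ++ [a + 1 + k] := by
  rw [List.range'_1_concat, List.map_append, map_shiftAbove_of_le]
  · simp [shiftAbove, Nat.add_comm]
  · intro y hy
    rw [List.mem_range'_1] at hy
    omega

theorem map_shiftSkip_range' (a k d : ℕ) :
    (List.range' 1 (k + d)).map (shiftSkip a k) =
      List.range' (1 + a) k ++ List.range' (1 + a + k + 1) d := by
  rw [← List.range'_append_1, List.map_append]
  congr 1
  · rw [Nat.add_comm 1 a, ← List.map_add_range']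
    refine List.map_congr_left fun y hy => ?_
    rw [List.mem_range'_1] at hy
    simp only [shiftSkip]
    rw [if_pos (by omega), Nat.add_comm]
  · rw [show 1 + a + k + 1 = (a + 1) + (1 + k) by omega, ← List.map_add_range' (1 + k) d]
    refine List.map_congr_left fun y hy => ?_
    rw [List.mem_range'_1] at hy
    simp only [shiftSkip]
    rw [if_neg (by omega)]
    omega

/-- The ordering `L' n R'` of `1, …, n`, where `L'` and `R'` have the same relative orders as `L`
and `R`, every entry of `L'` but its largest is smaller than every entry of `R'`, and exactly `k`
entries of `R'` are smaller than the largest entry of `L'`. -/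
def interleave (k : ℕ) (L R : List ℕ) : List ℕ :=
  L.map (shiftAbove (L.length - 1) k) ++
    (L.length + R.length + 1) :: R.map (shiftSkip (L.length - 1) k)

theorem perm_blocks {α : Type*} (A B C D E : List α) :
    (A ++ B ++ (C ++ (D ++ E))).Perm (A ++ (D ++ (B ++ (E ++ C)))) := by
  classical
  rw [List.perm_iff_count]
  intro c
  simp only [List.count_append]
  omega

/-- With p = a + 1 and n the largest entry, the image is T m C₁ C₂ n, where m = a + 1 + k is the
shifted maximum of L and C₁ < m < C₂ is the shifted image of R, cut at k. The one-pass criterion and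
the cut count apply to this form. -/
theorem interleave_spec {p q k : ℕ} {L R : List ℕ} (hL : L ∈ twoSortable p)
    (hR : R ∈ twoSortable q) (hk : k ∈ cuts (stackSort R)) :
    interleave k L R ∈ twoSortable (p + q + 1) ∧
    (∀ y ∈ L.map (shiftAbove (p - 1) k), y < p + q + 1) ∧
    (∀ y ∈ R.map (shiftSkip (p - 1) k), y < p + q + 1) ∧
    (cuts (stackSort (interleave k L R))).card = (cuts (stackSort L)).card +
      ((cuts (stackSort R)).filter (k < ·)).card + 1 := by
  have lL := length_of_mem_twoSortable hL
  have lR := length_of_mem_twoSortable hR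
  have dL := nodup_of_mem_twoSortable hL
  have dR := nodup_of_mem_twoSortable hR
  obtain ⟨pL, sL, nL⟩ := mem_twoSortable.1 hL
  obtain ⟨pR, sR, nR⟩ := mem_twoSortable.1 hR
  obtain ⟨a, rfl⟩ : ∃ a, p = a + 1 := Nat.exists_eq_succ_of_ne_zero fun h => nL (by
    rw [h] at lL
    exact List.length_eq_zero_iff.1 lL)
  obtain ⟨B₁, B₂, hB, rfl, h12⟩ := exists_append_of_mem_cuts hk
  rw [hB] at hk ⊢
  set k := B₁.length with hkdef
  set d := B₂.length with hddef
  have hq : q = k + d := by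
    rw [← lR, ← (stackSort_perm R).length_eq, hB, List.length_append]
  subst hq
  have pB : (B₁ ++ B₂).Perm (List.range' 1 (k + d)) := hB ▸ (stackSort_perm R).trans pR
  obtain ⟨pB₁, pB₂⟩ := perm_range'_of_append pB h12
  obtain ⟨A, A', eL, hA, hA', pA⟩ := exists_eq_append_cons_of_perm_range' pL
  have eA : stackSort L = (stackSort A ++ stackSort A') ++ [a + 1] := by
    rw [eL, stackSort_append_cons A A' _ hA hA']
  set T := stackSort A ++ stackSort A' with hT
  have hTlt : ∀ y ∈ T, y < a + 1 := by
    intro y hy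
    rw [hT, List.mem_append, mem_stackSort, mem_stackSort] at hy
    exact hy.elim (hA y) (hA' y)
  have eL' : stackSort (L.map (shiftAbove a k)) = T ++ [a + 1 + k] := by
    rw [stackSort_map (shiftAbove_strictMono a k) L dL, eA, List.map_append,
      map_shiftAbove_of_le fun y hy => Nat.lt_succ_iff.1 (hTlt y hy)]
    simp [shiftAbove]
  set C₁ := B₁.map (shiftSkip a k) with hC₁
  set C₂ := B₂.map (shiftSkip a k) with hC₂
  have eR' : stackSort (R.map (shiftSkip a k)) = C₁ ++ C₂ := by
    rw [stackSort_map (shiftSkip_strictMono a k) R dR, hB, List.map_append]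
  have hC₁b : ∀ y ∈ C₁, a < y ∧ y < a + 1 + k := by
    intro y hy
    obtain ⟨z, hz, rfl⟩ := List.mem_map.1 hy
    have := List.mem_range'_1.1 (pB₁.mem_iff.1 hz)
    rw [shiftSkip, if_pos (by omega)]
    omega
  have hC₂b : ∀ y ∈ C₂, a + 1 + k < y ∧ y < a + 1 + (k + d) + 1 := by
    intro y hy
    obtain ⟨z, hz, rfl⟩ := List.mem_map.1 hy
    have := List.mem_range'_1.1 (pB₂.mem_iff.1 hz)
    rw [shiftSkip, if_neg (by omega)]
    omega
  have hLlt : ∀ y ∈ L.map (shiftAbove a k), y < a + 1 + (k + d) + 1 := by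
    intro y hy
    rw [← mem_stackSort, eL', List.mem_append, List.mem_singleton] at hy
    rcases hy with hy | rfl
    · have := hTlt y hy
      omega
    · omega
  have hRlt : ∀ y ∈ R.map (shiftSkip a k), y < a + 1 + (k + d) + 1 := by
    intro y hy
    rw [← mem_stackSort, eR', List.mem_append] at hy
    rcases hy with hy | hy
    · have := hC₁b y hy
      omega
    · have := hC₂b y hy
      omega
  have eI : interleave k L R = L.map (shiftAbove a k) ++
      (a + 1 + (k + d) + 1) :: R.map (shiftSkip a k) := by
    rw [interleave, lL, lR, Nat.add_sub_cancel]
  have eS : stackSort (interleave k L R) =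
      (T ++ (a + 1 + k) :: (C₁ ++ C₂)) ++ [a + 1 + (k + d) + 1] := by
    rw [eI, stackSort_append_cons _ _ _ hLlt hRlt, eL', eR']
    simp
  have hSlt : ∀ y ∈ T ++ (a + 1 + k) :: (C₁ ++ C₂), y < a + 1 + (k + d) + 1 := by
    intro y hy
    have e : T ++ (a + 1 + k) :: (C₁ ++ C₂) = (T ++ [a + 1 + k]) ++ (C₁ ++ C₂) := by simp
    rw [e, ← eL', ← eR', List.mem_append, mem_stackSort, mem_stackSort] at hy
    exact hy.elim (hLlt y) (hRlt y)
  have hTk : ∀ y ∈ T, y < a + 1 + k := fun y hy => (hTlt y hy).trans_le (Nat.le_add_right _ _)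
  have hTC : ∀ u ∈ T, ∀ v ∈ C₁ ++ C₂, u < v := by
    intro u hu v hv
    have h1 := hTlt u hu
    rcases List.mem_append.1 hv with hv | hv
    · have := hC₁b v hv
      omega
    · have := hC₂b v hv
      omega
  refine ⟨mem_twoSortable.2 ⟨?_, ?_, ?_⟩, hLlt, hRlt, ?_⟩
  · have q1 := pL.map (shiftAbove a k)
    have q2 := pR.map (shiftSkip a k)
    rw [map_shiftAbove_range'] at q1
    rw [map_shiftSkip_range'] at q2
    have q3 := q1.append (q2.cons (a + 1 + (k + d) + 1))
    rw [eI]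
    -- In increasing order the values are 1, …, a from L, the k small values of R, m, the d large
    -- values of R, and n.
    refine q3.trans ((perm_blocks _ _ [_] _ _).trans (List.Perm.of_eq ?_))
    rw [show a + 1 + (k + d) + 1 = a + (k + (1 + (d + 1))) by omega,
      ← List.range'_append_1 (m := a), ← List.range'_append_1 (m := k),
      ← List.range'_append_1 (m := 1), ← List.range'_append_1 (m := d)]
    simp only [List.range'_one]
    rw [show 1 + a + k = a + 1 + k by omega,
      show a + 1 + k + 1 + d = a + (k + (1 + (d + 1))) by omega]
  · have hdup : ((a + 1 + k) :: (C₁ ++ C₂)).Nodup := by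
      rw [List.nodup_cons]
      constructor
      · intro h
        rcases List.mem_append.1 h with h | h
        · exact (hC₁b _ h).2.false
        · exact (hC₂b _ h).1.false
      · rw [← eR']
        exact (stackSort_perm _).nodup_iff.2 (dR.map (shiftSkip_strictMono a k).injective)
    rw [eS, stackSort_append_singleton _ _ hSlt, List.pairwise_append,
      stackSort_append_cons_pairwise_lt_iff hTk _ hdup]
    have sT : (stackSort T).Pairwise (· < ·) := by
      rw [eA, stackSort_append_singleton _ _ hTlt] at sL
      exact (List.pairwise_append.1 sL).1
    refine ⟨⟨sT, ?_, hTC, C₁, C₂, rfl, fun v hv => (hC₁b v hv).2, fun v hv => (hC₂b v hv).1⟩,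
      List.pairwise_singleton _ _, ?_⟩
    · rw [← List.map_append, ← hB, stackSort_map (shiftSkip_strictMono a k) _
        ((stackSort_perm R).nodup_iff.2 dR), List.pairwise_map]
      exact sR.imp fun h => shiftSkip_strictMono a k h
    · intro u hu v hv
      rw [List.mem_singleton.1 hv]
      exact hSlt u (mem_stackSort.1 hu)
  · rw [eI]
    simp
  · have hlen : C₁.length = k := by rw [hC₁, List.length_map]
    rw [eS, card_cuts_append_singleton hSlt, card_cuts_append_cons hTk hTC
      (fun v hv => (hC₁b v hv).2) (fun v hv => (hC₂b v hv).1), hlen, eA,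
      card_cuts_append_singleton hTk, card_cuts_append_singleton hTlt, ← List.map_append,
      cuts_map (shiftSkip_strictMono a k)]

/-- Here k is the number of entries of R below the maximum m of L, and L₀, R₀ are the
standardizations of L and R. -/
theorem exists_interleave_eq {n : ℕ} {L R : List ℕ} (hLn : L ≠ []) (hRn : R ≠ [])
    (hL : ∀ y ∈ L, y < n + 1) (hR : ∀ y ∈ R, y < n + 1)
    (h : L ++ (n + 1) :: R ∈ twoSortable (n + 1)) :
    ∃ p q L₀ R₀ k, p + q = n ∧ L₀ ∈ twoSortable p ∧ R₀ ∈ twoSortable q ∧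
      k ∈ cuts (stackSort R₀) ∧ interleave k L₀ R₀ = L ++ (n + 1) :: R := by
  obtain ⟨hp, hs, -⟩ := mem_twoSortable.1 h
  have hLR : (L ++ R).Perm (List.range' 1 n) := by
    rw [List.range'_1_concat, Nat.add_comm 1 n] at hp
    exact (List.perm_middle.symm.trans (hp.trans (List.perm_append_singleton _ _))).cons_inv
  have hd : (L ++ R).Nodup := hLR.nodup_iff.2 List.nodup_range'
  have dL := (List.nodup_append.1 hd).1
  have dR := (List.nodup_append.1 hd).2.1
  obtain ⟨A, m, A', rfl, hA, hA'⟩ := exists_eq_append_max hLn dL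
  have eA := stackSort_append_cons A A' m hA hA'
  generalize hT : stackSort A ++ stackSort A' = T at eA
  have hTlt : ∀ y ∈ T, y < m := by
    intro y hy
    rw [← hT, List.mem_append, mem_stackSort, mem_stackSort] at hy
    exact hy.elim (hA y) (hA' y)
  have hSlt : ∀ y ∈ T ++ m :: stackSort R, y < n + 1 := by
    intro y hy
    have e : T ++ m :: stackSort R = stackSort (A ++ m :: A') ++ stackSort R := by simp [eA]
    rw [e, List.mem_append, mem_stackSort, mem_stackSort] at hy
    exact hy.elim (hL y) (hR y)
  have hmem : ∀ y ∈ stackSort R, y ≠ m := by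
    rintro y hy rfl
    exact (List.nodup_append.1 hd).2.2 y (by simp) y (mem_stackSort.1 hy) rfl
  rw [stackSort_append_cons _ _ _ hL hR, eA, List.append_assoc T, List.singleton_append,
    stackSort_append_singleton _ _ hSlt, List.pairwise_append,
    stackSort_append_cons_pairwise_lt_iff hTlt _ (List.nodup_cons.2
      ⟨fun hm => hmem m hm rfl, (stackSort_perm R).nodup_iff.2 dR⟩)] at hs
  obtain ⟨⟨sT, sR, hTR, B₁, B₂, hB, h1, h2⟩, -⟩ := hs
  have pL : (A ++ m :: A').Perm (T ++ [m]) := (eA ▸ stackSort_perm (A ++ m :: A')).symm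
  have pR : R.Perm (B₁ ++ B₂) := (hB ▸ stackSort_perm R).symm
  -- The blocks T, B₁, m, B₂ increase in value, so each fills an interval of 1, …, n; this fixes m
  -- and the relabelling maps.
  have hall : (T ++ (B₁ ++ (m :: B₂))).Perm (List.range' 1 n) := by
    refine List.Perm.trans ?_ ((pL.append pR).symm.trans hLR)
    rw [List.append_assoc, List.singleton_append]
    exact List.perm_middle.append_left T
  have hlen : n = T.length + (B₁ ++ m :: B₂).length := by
    have := hall.length_eq
    rw [List.length_range', List.length_append] at this
    exact this.symm
  rw [hlen] at hall
  obtain ⟨pT, pV⟩ := perm_range'_of_append hall (by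
    intro u hu v hv
    rcases List.mem_append.1 hv with hv | hv
    · exact hTR u hu v (hB ▸ List.mem_append_left _ hv)
    · rcases List.mem_cons.1 hv with rfl | hv
      · exact hTlt u hu
      · exact hTR u hu v (hB ▸ List.mem_append_right _ hv))
  rw [List.length_append] at pV
  obtain ⟨pB₁, pV⟩ := perm_range'_of_append pV (by
    intro u hu v hv
    rcases List.mem_cons.1 hv with rfl | hv
    · exact h1 u hu
    · exact (h1 u hu).trans (h2 v hv))
  rw [List.length_cons, Nat.add_comm B₂.length 1] at pV
  obtain ⟨pm, pB₂⟩ := perm_range'_of_append (U := [m]) pV (by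
    intro u hu v hv
    rw [List.mem_singleton.1 hu]
    exact h2 v hv)
  have hm : m = T.length + 1 + B₁.length := by
    have := pm.subset (List.mem_singleton_self m)
    simp only [List.length_singleton, List.range'_one, List.mem_singleton] at this
    omega
  obtain ⟨L₀, pL₀, eL₀⟩ := exists_perm_eq_map (w := A ++ m :: A')
    (shiftAbove_strictMono T.length B₁.length).injective
    (l := List.range' 1 (T.length + 1)) (by
      rw [map_shiftAbove_range', ← hm]
      exact pL.trans (pT.append_right [m]))
  obtain ⟨R₀, pR₀, eR₀⟩ := exists_perm_eq_map (w := R)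
    (shiftSkip_strictMono T.length B₁.length).injective
    (l := List.range' 1 (B₁.length + B₂.length)) (by
      rw [map_shiftSkip_range']
      exact pR.trans (pB₁.append pB₂))
  have dL₀ : L₀.Nodup := pL₀.nodup_iff.2 List.nodup_range'
  have dR₀ : R₀.Nodup := pR₀.nodup_iff.2 List.nodup_range'
  have fL := shiftAbove_strictMono T.length B₁.length
  have fR := shiftSkip_strictMono T.length B₁.length
  refine ⟨T.length + 1, B₁.length + B₂.length, L₀, R₀, B₁.length, ?_,
    mem_twoSortable.2 ⟨pL₀, ?_, ?_⟩, mem_twoSortable.2 ⟨pR₀, ?_, ?_⟩, ?_, ?_⟩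
  · rw [hlen, List.length_append, List.length_cons]
    omega
  · have e : stackSort (stackSort (A ++ m :: A')) = (stackSort (stackSort L₀)).map
        (shiftAbove T.length B₁.length) := by
      rw [eL₀, stackSort_map fL _ dL₀, stackSort_map fL _ ((stackSort_perm L₀).nodup_iff.2 dL₀)]
    have sL : (stackSort (stackSort (A ++ m :: A'))).Pairwise (· < ·) := by
      rw [eA, stackSort_append_singleton _ _ hTlt]
      refine List.pairwise_append.2 ⟨sT, List.pairwise_singleton _ _, fun u hu v hv => ?_⟩
      rw [List.mem_singleton.1 hv]
      exact hTlt u (mem_stackSort.1 hu)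
    rw [e, List.pairwise_map] at sL
    exact sL.imp fun h => fL.lt_iff_lt.1 h
  · rintro rfl
    simp at eL₀
  · rw [eR₀, stackSort_map fR _ dR₀, stackSort_map fR _ ((stackSort_perm R₀).nodup_iff.2 dR₀),
      List.pairwise_map] at sR
    exact sR.imp fun h => fR.lt_iff_lt.1 h
  · rintro rfl
    exact hRn (by simpa using eR₀)
  · rw [← cuts_map fR, ← stackSort_map fR _ dR₀, ← eR₀, hB, mem_cuts_append]
    exact fun u hu v hv => (h1 u hu).trans (h2 v hv)
  · rw [interleave, pL₀.length_eq, pR₀.length_eq, List.length_range', List.length_range',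
      Nat.add_sub_cancel, ← eL₀, ← eR₀]
    congr 2
    rw [hlen, List.length_append, List.length_cons]
    omega

/-- The largest entry of the shifted word is a + 1 + k, so the word determines k; one inequality
suffices by symmetry. -/
theorem le_of_map_shiftAbove_eq {a k k' : ℕ} {L L' : List ℕ} (hL : L ∈ twoSortable (a + 1))
    (hL' : L' ∈ twoSortable (a + 1))
    (h : L.map (shiftAbove a k) = L'.map (shiftAbove a k')) : k ≤ k' := by
  have h1 : a + 1 ∈ L := (mem_twoSortable.1 hL).1.mem_iff.2 (List.mem_range'_1.2 (by omega))
  have h2 := List.mem_map_of_mem (f := shiftAbove a k) h1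
  rw [h] at h2
  obtain ⟨y, hy, he⟩ := List.mem_map.1 h2
  have h3 := lt_of_mem_twoSortable hL' y hy
  rw [shiftAbove, shiftAbove, if_neg (show ¬ a + 1 ≤ a by omega)] at he
  split_ifs at he <;> omega

theorem interleave_injective {p q p' q' k k' : ℕ} {L R L' R' : List ℕ} (hpq : p + q = p' + q')
    (hL : L ∈ twoSortable p) (hR : R ∈ twoSortable q) (hk : k ∈ cuts (stackSort R))
    (hL' : L' ∈ twoSortable p') (hR' : R' ∈ twoSortable q') (hk' : k' ∈ cuts (stackSort R'))
    (h : interleave k L R = interleave k' L' R') :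
    p = p' ∧ q = q' ∧ L = L' ∧ R = R' ∧ k = k' := by
  have hs := interleave_spec hL hR hk
  have hs' := interleave_spec hL' hR' hk'
  have lL := length_of_mem_twoSortable hL
  have lR := length_of_mem_twoSortable hR
  have lL' := length_of_mem_twoSortable hL'
  have lR' := length_of_mem_twoSortable hR'
  have nL := (mem_twoSortable.1 hL).2.2
  rw [interleave, interleave, lL, lR, lL', lR', ← hpq, List.append_cons_inj_of_notMem
    (fun hm => (hs.2.1 _ hm).false) (fun hm => (hs.2.2.1 _ hm).false)] at h
  obtain ⟨h1, -, h2⟩ := h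
  have hp : p = p' := by
    have := congrArg List.length h1
    rwa [List.length_map, List.length_map, lL, lL'] at this
  subst hp
  obtain rfl : q = q' := by omega
  obtain ⟨a, rfl⟩ : ∃ a, p = a + 1 := Nat.exists_eq_succ_of_ne_zero fun h => nL (by
    rw [h] at lL
    exact List.length_eq_zero_iff.1 lL)
  rw [Nat.add_sub_cancel] at h1 h2
  obtain rfl : k = k' :=
    le_antisymm (le_of_map_shiftAbove_eq hL hL' h1) (le_of_map_shiftAbove_eq hL' hL h1.symm)
  exact ⟨rfl, rfl, List.map_injective_iff.2 (shiftAbove_strictMono a k).injective h1,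
    List.map_injective_iff.2 (shiftSkip_strictMono a k).injective h2, rfl⟩

theorem perm_range'_succ {n : ℕ} {w : List ℕ} :
    ((n + 1) :: w).Perm (List.range' 1 (n + 1)) ↔ w.Perm (List.range' 1 n) := by
  rw [List.range'_1_concat, Nat.add_comm 1 n]
  exact ⟨fun h => (h.trans (List.perm_append_singleton _ _)).cons_inv,
    fun h => (h.cons _).trans (List.perm_append_singleton _ _).symm⟩

theorem pairwise_lt_append_singleton {w : List ℕ} {m : ℕ} (h : ∀ y ∈ w, y < m) :
    (w ++ [m]).Pairwise (· < ·) ↔ w.Pairwise (· < ·) := by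
  rw [List.pairwise_append]
  refine ⟨fun hw => hw.1, fun hw => ⟨hw, List.pairwise_singleton _ _, fun u hu v hv => ?_⟩⟩
  rw [List.mem_singleton.1 hv]
  exact h u hu

theorem append_singleton_mem_twoSortable {n : ℕ} {w : List ℕ} (hw : w ≠ [])
    (h : ∀ y ∈ w, y < n + 1) : w ++ [n + 1] ∈ twoSortable (n + 1) ↔ w ∈ twoSortable n := by
  have h' : ∀ y ∈ stackSort w, y < n + 1 := fun y hy => h y (mem_stackSort.1 hy)
  have h'' : ∀ y ∈ stackSort (stackSort w), y < n + 1 := fun y hy => h' y (mem_stackSort.1 hy)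
  rw [mem_twoSortable, mem_twoSortable, stackSort_append_singleton w _ h,
    stackSort_append_singleton _ _ h', pairwise_lt_append_singleton h'',
    List.Perm.congr_left (List.perm_append_singleton (n + 1) w), perm_range'_succ]
  simp [hw]

theorem cons_mem_twoSortable {n : ℕ} {w : List ℕ} (hw : w ≠ [])
    (h : ∀ y ∈ w, y < n + 1) : (n + 1) :: w ∈ twoSortable (n + 1) ↔ w ∈ twoSortable n := by
  have h' : ∀ y ∈ stackSort w, y < n + 1 := fun y hy => h y (mem_stackSort.1 hy)
  have h'' : ∀ y ∈ stackSort (stackSort w), y < n + 1 := fun y hy => h' y (mem_stackSort.1 hy)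
  rw [mem_twoSortable, mem_twoSortable, stackSort_cons w _ h,
    stackSort_append_singleton _ _ h', pairwise_lt_append_singleton h'', perm_range'_succ]
  simp [hw]

theorem twoSortable_zero : twoSortable 0 = ∅ := by
  refine Finset.eq_empty_of_forall_notMem fun w hw => ?_
  have := mem_twoSortable.1 hw
  exact this.2.2 (List.perm_nil.1 this.1)

theorem twoSortable_one : twoSortable 1 = {[1]} := by
  ext w
  rw [mem_twoSortable, Finset.mem_singleton]
  constructor
  · exact fun h => List.perm_singleton.1 h.1
  · rintro rfl
    have h := stackSort_cons [] 1 (by simp)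
    rw [stackSort_nil] at h
    simp only [List.nil_append] at h
    simp [h]

/-- The index set of the words `L n R` in `twoSortable` with `L` and `R` nonempty. -/
def interleaveIndex (n : ℕ) : Finset (Σ _ : ℕ × ℕ, Σ _ : List ℕ × List ℕ, ℕ) :=
  (Finset.HasAntidiagonal.antidiagonal n).sigma fun p => (twoSortable p.1 ×ˢ twoSortable p.2).sigma fun z =>
    cuts (stackSort z.2)

theorem mem_interleaveIndex {n : ℕ} {p q k : ℕ} {L R : List ℕ} :
    ⟨(p, q), (L, R), k⟩ ∈ interleaveIndex n ↔
      p + q = n ∧ (L ∈ twoSortable p ∧ R ∈ twoSortable q) ∧ k ∈ cuts (stackSort R) := by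
  simp [interleaveIndex]

theorem twoSortable_succ {n : ℕ} (hn : n ≠ 0) : twoSortable (n + 1) =
    (twoSortable n).image (· ++ [n + 1]) ∪ ((twoSortable n).image ((n + 1) :: ·) ∪
      (interleaveIndex n).image fun z => interleave z.2.2 z.2.1.1 z.2.1.2) := by
  ext w
  simp only [Finset.mem_union, Finset.mem_image]
  constructor
  · intro hw
    obtain ⟨L, R, rfl, hL, hR, hp⟩ := exists_eq_append_cons_of_perm_range' (mem_twoSortable.1 hw).1
    by_cases hRn : R = []
    · subst hRn
      have hLn : L ≠ [] := by
        rintro rfl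
        have := hp.length_eq
        simp at this
        omega
      exact Or.inl ⟨L, (append_singleton_mem_twoSortable hLn hL).1 hw, rfl⟩
    · by_cases hLn : L = []
      · subst hLn
        exact Or.inr (Or.inl ⟨R, (cons_mem_twoSortable hRn hR).1 hw, rfl⟩)
      · obtain ⟨p, q, L₀, R₀, k, h1, h2, h3, h4, h5⟩ := exists_interleave_eq hLn hRn hL hR hw
        exact Or.inr (Or.inr ⟨⟨(p, q), (L₀, R₀), k⟩,
          mem_interleaveIndex.2 ⟨h1, ⟨h2, h3⟩, h4⟩, h5⟩)
  · rintro (⟨v, hv, rfl⟩ | ⟨v, hv, rfl⟩ | ⟨⟨⟨p, q⟩, ⟨L, R⟩, k⟩, h, rfl⟩)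
    · exact (append_singleton_mem_twoSortable (mem_twoSortable.1 hv).2.2
        (lt_of_mem_twoSortable hv)).2 hv
    · exact (cons_mem_twoSortable (mem_twoSortable.1 hv).2.2 (lt_of_mem_twoSortable hv)).2 hv
    · rw [mem_interleaveIndex] at h
      obtain ⟨rfl, ⟨h1, h2⟩, h3⟩ := h
      exact (interleave_spec h1 h2 h3).1

theorem exists_interleave_eq_append {n p q k : ℕ} {L R : List ℕ}
    (h : ⟨(p, q), (L, R), k⟩ ∈ interleaveIndex n) :
    ∃ L' R', interleave k L R = L' ++ (n + 1) :: R' ∧ L' ≠ [] ∧ R' ≠ [] ∧ (n + 1) ∉ L' ∧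
      (n + 1) ∉ R' := by
  rw [mem_interleaveIndex] at h
  obtain ⟨rfl, ⟨h1, h2⟩, h3⟩ := h
  have hs := interleave_spec h1 h2 h3
  refine ⟨L.map (shiftAbove (p - 1) k), R.map (shiftSkip (p - 1) k), ?_, ?_, ?_, ?_, ?_⟩
  · rw [interleave, length_of_mem_twoSortable h1, length_of_mem_twoSortable h2]
  · simpa using (mem_twoSortable.1 h1).2.2
  · simpa using (mem_twoSortable.1 h2).2.2
  · exact fun hm => (hs.2.1 _ hm).false
  · exact fun hm => (hs.2.2.1 _ hm).false

/-- Sums over `twoSortable (n + 1)`, split by the position of the largest entry. -/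
theorem sum_twoSortable_succ {M : Type*} [AddCommMonoid M] {n : ℕ} (hn : n ≠ 0)
    (F : List ℕ → M) : ∑ w ∈ twoSortable (n + 1), F w =
      ∑ w ∈ twoSortable n, F (w ++ [n + 1]) + (∑ w ∈ twoSortable n, F ((n + 1) :: w) +
        ∑ p ∈ Finset.HasAntidiagonal.antidiagonal n, ∑ L ∈ twoSortable p.1, ∑ R ∈ twoSortable p.2,
          ∑ k ∈ cuts (stackSort R), F (interleave k L R)) := by
  rw [twoSortable_succ hn, Finset.sum_union, Finset.sum_union, Finset.sum_image, Finset.sum_image,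
    Finset.sum_image]
  · simp only [interleaveIndex, Finset.sum_sigma, Finset.sum_product]
  · rintro ⟨⟨p, q⟩, ⟨L, R⟩, k⟩ h ⟨⟨p', q'⟩, ⟨L', R'⟩, k'⟩ h' he
    rw [Finset.mem_coe, mem_interleaveIndex] at h h'
    obtain ⟨rfl, rfl, rfl, rfl, rfl⟩ := interleave_injective (h.1.trans h'.1.symm) h.2.1.1 h.2.1.2
      h.2.2 h'.2.1.1 h'.2.1.2 h'.2.2 he
    rfl
  · exact fun _ _ _ _ he => List.tail_eq_of_cons_eq he
  · exact fun _ _ _ _ he => List.append_cancel_right he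
  · rw [Finset.disjoint_left]
    rintro w hw hw'
    obtain ⟨v, hv, rfl⟩ := Finset.mem_image.1 hw
    obtain ⟨⟨⟨p, q⟩, ⟨L, R⟩, k⟩, h, he⟩ := Finset.mem_image.1 hw'
    obtain ⟨L', R', h1, h2, h3, h4, h5⟩ := exists_interleave_eq_append h
    rw [h1] at he
    exact h2 ((List.append_cons_inj_of_notMem (x₂ := []) h4 h5).1 he).1
  · rw [Finset.disjoint_left]
    rintro w hw hw'
    obtain ⟨v, hv, rfl⟩ := Finset.mem_image.1 hw
    rcases Finset.mem_union.1 hw' with hw' | hw'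
    · obtain ⟨v', hv', he⟩ := Finset.mem_image.1 hw'
      have hm : n + 1 ∉ v' := fun hm => (lt_of_mem_twoSortable hv' _ hm).false
      exact (mem_twoSortable.1 hv').2.2
        ((List.append_cons_inj_of_notMem (x₁ := []) (by simp) hm).1 he).2.2
    · obtain ⟨⟨⟨p, q⟩, ⟨L, R⟩, k⟩, h, he⟩ := Finset.mem_image.1 hw'
      obtain ⟨L', R', h1, h2, h3, h4, h5⟩ := exists_interleave_eq_append h
      rw [h1] at he
      exact h3 ((List.append_cons_inj_of_notMem h4 h5).1 he).2.2

/-! ### Coefficients of the generating function. -/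

/-- The value m' need not be the image of m, so `cutPoly_map` does not apply directly; but X times
either side depends only on the cutting polynomial and fertility of w. -/
theorem cutPoly_append_singleton_map {f : ℕ → ℕ} (hf : StrictMono f) {w : List ℕ} {m m' : ℕ}
    (hw : w.Nodup) (hne : w ≠ []) (h : ∀ y ∈ w, y < m) (h' : ∀ y ∈ w.map f, y < m') :
    cutPoly (w.map f ++ [m']) = cutPoly (w ++ [m]) := by
  refine mul_left_cancel₀ (X_ne_zero (R := ℤ)) ?_
  rw [X_mul_cutPoly_append_singleton h hne, X_mul_cutPoly_append_singleton h' (by simpa using hne),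
    cutPoly_map hf hw, fertility_map hf hw]

/-- `cutPoly w`, as a polynomial in `a` over `ℤ[x]`. -/
noncomputable def cutPolyA (w : List ℕ) : ℤ[X][X] := (cutPoly w).map C

/-- The coefficient of `tⁿ` in the generating function `Q`. -/
noncomputable def coeffQ (n : ℕ) : ℤ[X][X] :=
  ∑ w ∈ twoSortable n, (1 + C X) ^ (cuts (stackSort w)).card * ((1 + X) ^ 2 * cutPolyA w)

/-- The coefficient of `tⁿ` in `(Q(x, a) - Q(x, 0)) / a`. -/
noncomputable def coeffD (n : ℕ) : ℤ[X][X] :=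
  ∑ w ∈ twoSortable n, (1 + C X) ^ (cuts (stackSort w)).card * cutPolyA (w ++ [n + 1])

/-- The coefficient of `tⁿ` in `(Q(x, a) - Q(0, a)) / x`. -/
noncomputable def coeffE (n : ℕ) : ℤ[X][X] :=
  ∑ w ∈ twoSortable n, (∑ i ∈ Finset.range (cuts (stackSort w)).card, (1 + C X) ^ i) *
    ((1 + X) ^ 2 * cutPolyA w)

theorem X_mul_cutPolyA_append_singleton {m : ℕ} {w : List ℕ} (h : ∀ y ∈ w, y < m) (hne : w ≠ []) :
    X * cutPolyA (w ++ [m]) = (1 + X) ^ 2 * cutPolyA w - (fertility w : ℤ[X][X]) := by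
  have := congrArg (Polynomial.map (C : ℤ →+* ℤ[X])) (X_mul_cutPoly_append_singleton h hne)
  simpa [cutPolyA] using this

theorem eval_zero_cutPolyA {w : List ℕ} (hne : w ≠ []) :
    (cutPolyA w).eval 0 = (fertility w : ℤ[X]) := by
  rw [cutPolyA, ← C_0, eval_map, eval₂_at_apply, eval_zero_cutPoly hne]
  simp

theorem map_cutPolyA (w : List ℕ) :
    (cutPolyA w).map (C.comp (evalRingHom 0)) = cutPolyA w := by
  rw [cutPolyA, Polynomial.map_map]
  congr 1
  ext
  simp

/-- Holds word by word: the subtracted fertility is the value at a = 0 of (1 + a)² times the cutting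
polynomial. -/
theorem X_mul_coeffD (n : ℕ) :
    X * coeffD n = coeffQ n - C.comp (evalRingHom 0) (coeffQ n) := by
  rw [coeffD, coeffQ, map_sum, ← Finset.sum_sub_distrib, Finset.mul_sum]
  refine Finset.sum_congr rfl fun w hw => ?_
  have hne := (mem_twoSortable.1 hw).2.2
  rw [mul_left_comm, X_mul_cutPolyA_append_singleton (lt_of_mem_twoSortable hw) hne, mul_sub]
  congr 1
  simp [eval_zero_cutPolyA hne]

theorem C_X_mul_coeffE (n : ℕ) :
    C X * coeffE n = coeffQ n - mapRingHom (C.comp (evalRingHom 0)) (coeffQ n) := by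
  rw [coeffE, coeffQ, map_sum, ← Finset.sum_sub_distrib, Finset.mul_sum]
  refine Finset.sum_congr rfl fun w hw => ?_
  have hg := geom_sum_mul (1 + C X : ℤ[X][X]) (cuts (stackSort w)).card
  have e : mapRingHom (C.comp (evalRingHom 0)) ((1 + C X) ^ (cuts (stackSort w)).card *
      ((1 + X) ^ 2 * cutPolyA w)) = (1 + X) ^ 2 * cutPolyA w := by
    simp [map_cutPolyA]
  rw [e]
  linear_combination ((1 + X) ^ 2 * cutPolyA w) * hg

theorem coeffQ_zero : coeffQ 0 = 0 := by
  rw [coeffQ, twoSortable_zero, Finset.sum_empty]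

theorem coeffD_zero : coeffD 0 = 0 := by
  rw [coeffD, twoSortable_zero, Finset.sum_empty]

theorem coeffQ_one : coeffQ 1 = (1 + C X) ^ 2 * (1 + X) ^ 2 := by
  have h := stackSort_append_singleton [] 1 (by simp)
  have hc := card_cuts_append_singleton (A := []) (m := 1) (by simp)
  have h0 : (cuts []).card = 1 := by
    rw [Finset.card_eq_one]
    refine ⟨0, Finset.ext fun j => ?_⟩
    simp [mem_cuts]
  rw [stackSort_nil] at h
  rw [h0] at hc
  rw [List.nil_append] at h hc
  rw [coeffQ, twoSortable_one, Finset.sum_singleton, h, hc, cutPolyA, cutPoly_singleton,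
    Polynomial.map_one, mul_one]

theorem weight_append_singleton {n : ℕ} {w : List ℕ} (hw : w ∈ twoSortable n) :
    (cuts (stackSort (w ++ [n + 1]))).card = (cuts (stackSort w)).card + 1 := by
  rw [stackSort_append_singleton _ _ (lt_of_mem_twoSortable hw), card_cuts_append_singleton]
  exact fun y hy => lt_of_mem_twoSortable hw y (mem_stackSort.1 hy)

theorem weight_cons {n : ℕ} {w : List ℕ} (hw : w ∈ twoSortable n) :
    (cuts (stackSort ((n + 1) :: w))).card = (cuts (stackSort w)).card + 1 := by
  rw [stackSort_cons _ _ (lt_of_mem_twoSortable hw), card_cuts_append_singleton]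
  exact fun y hy => lt_of_mem_twoSortable hw y (mem_stackSort.1 hy)

theorem cutPolyA_cons {n : ℕ} {w : List ℕ} (hw : w ∈ twoSortable n) :
    cutPolyA ((n + 1) :: w) = X * cutPolyA w := by
  have := cutPoly_append_cons (L := []) (by simp) (lt_of_mem_twoSortable hw)
    (mem_twoSortable.1 hw).2.2
  rw [List.nil_append, List.nil_append, cutPoly_singleton, mul_one] at this
  rw [cutPolyA, cutPolyA, this, Polynomial.map_mul, Polynomial.map_X]

theorem cutPolyA_interleave {p q k : ℕ} {L R : List ℕ} (hL : L ∈ twoSortable p)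
    (hR : R ∈ twoSortable q) (hk : k ∈ cuts (stackSort R)) :
    cutPolyA (interleave k L R) = X * cutPolyA (L ++ [p + 1]) * cutPolyA R := by
  have hs := interleave_spec hL hR hk
  have e := cutPoly_append_cons hs.2.1 hs.2.2.1 (by simpa using (mem_twoSortable.1 hR).2.2)
  rw [cutPoly_append_singleton_map (shiftAbove_strictMono _ _) (nodup_of_mem_twoSortable hL)
    (mem_twoSortable.1 hL).2.2 (lt_of_mem_twoSortable hL) hs.2.1,
    cutPoly_map (shiftSkip_strictMono _ _) (nodup_of_mem_twoSortable hR)] at e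
  rw [cutPolyA, interleave, length_of_mem_twoSortable hL, length_of_mem_twoSortable hR, e,
    Polynomial.map_mul, Polynomial.map_mul, Polynomial.map_X, cutPolyA, cutPolyA]

/-- The three summands are the words with n + 1 last, strictly inside, and first. The inner sum over
the cut k becomes the geometric sum in `coeffE`. -/
theorem coeffQ_succ {n : ℕ} (hn : n ≠ 0) :
    coeffQ (n + 1) = (1 + C X) * (1 + X) ^ 2 * coeffD n +
      (1 + C X) * X * ∑ p ∈ Finset.HasAntidiagonal.antidiagonal n, coeffD p.1 * coeffE p.2 +
      (1 + C X) * X * coeffQ n := by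
  rw [coeffQ, sum_twoSortable_succ hn]
  have h1 : ∑ w ∈ twoSortable n, (1 + C X) ^ (cuts (stackSort (w ++ [n + 1]))).card *
      ((1 + X) ^ 2 * cutPolyA (w ++ [n + 1])) = (1 + C X) * (1 + X) ^ 2 * coeffD n := by
    rw [coeffD, Finset.mul_sum]
    refine Finset.sum_congr rfl fun w hw => ?_
    rw [weight_append_singleton hw]
    ring
  have h2 : ∑ w ∈ twoSortable n, (1 + C X) ^ (cuts (stackSort ((n + 1) :: w))).card *
      ((1 + X) ^ 2 * cutPolyA ((n + 1) :: w)) = (1 + C X) * X * coeffQ n := by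
    rw [coeffQ, Finset.mul_sum]
    refine Finset.sum_congr rfl fun w hw => ?_
    rw [weight_cons hw, cutPolyA_cons hw]
    ring
  have h3 : ∀ p : ℕ × ℕ, ∑ L ∈ twoSortable p.1, ∑ R ∈ twoSortable p.2,
      ∑ k ∈ cuts (stackSort R), (1 + C X) ^ (cuts (stackSort (interleave k L R))).card *
        ((1 + X) ^ 2 * cutPolyA (interleave k L R)) =
      (1 + C X) * X * (coeffD p.1 * coeffE p.2) := by
    intro p
    rw [coeffD, coeffE, Finset.sum_mul_sum, Finset.mul_sum]
    refine Finset.sum_congr rfl fun L hL => ?_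
    rw [Finset.mul_sum]
    refine Finset.sum_congr rfl fun R hR => ?_
    rw [← sum_pow_card_filter_lt, Finset.sum_mul, Finset.mul_sum, Finset.mul_sum]
    refine Finset.sum_congr rfl fun k hk => ?_
    rw [(interleave_spec hL hR hk).2.2.2, cutPolyA_interleave hL hR hk]
    ring
  rw [h1, h2, Finset.sum_congr rfl fun p _ => h3 p, ← Finset.mul_sum]
  ring

/-! ### The functional equation: existence and uniqueness. -/

/-- The right-hand side of the functional equation, coefficient by coefficient. -/
theorem functionalEquation_rhs_iff (Q D E : Ser) :
    Q = t * (x + 1) ^ 2 * (1 + a) ^ 2 + t * (1 + x) * D * ((1 + a) ^ 2 + a * E) +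
        t * (1 + x) * a * Q ↔
      PowerSeries.coeff 0 Q = 0 ∧ ∀ n, PowerSeries.coeff (n + 1) Q =
        (if n = 0 then (1 + C X) ^ 2 * (1 + X) ^ 2 else 0) +
        ((1 + C X) * (1 + X) ^ 2 * PowerSeries.coeff n D +
        (1 + C X) * X * ∑ p ∈ Finset.HasAntidiagonal.antidiagonal n,
          PowerSeries.coeff p.1 D * PowerSeries.coeff p.2 E +
        (1 + C X) * X * PowerSeries.coeff n Q) := by
  have e : t * (x + 1) ^ 2 * (1 + a) ^ 2 + t * (1 + x) * D * ((1 + a) ^ 2 + a * E) +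
      t * (1 + x) * a * Q = PowerSeries.X * (PowerSeries.C ((1 + C X) ^ 2 * (1 + X) ^ 2) +
        (PowerSeries.C ((1 + C X) * (1 + X) ^ 2) * D + PowerSeries.C ((1 + C X) * X) * (D * E) +
        PowerSeries.C ((1 + C X) * X) * Q)) := by
    simp only [t, x, a, map_mul, map_add, map_pow, map_one]
    ring
  rw [e]
  constructor
  · intro h
    refine ⟨?_, fun n => ?_⟩
    · rw [h, PowerSeries.coeff_zero_X_mul]
    · conv_lhs => rw [h]
      rw [PowerSeries.coeff_succ_X_mul]
      simp only [map_add, PowerSeries.coeff_C_mul]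
      rw [PowerSeries.coeff_C, PowerSeries.coeff_mul]
  · rintro ⟨h0, h1⟩
    ext1 n
    cases n with
    | zero => rw [h0, PowerSeries.coeff_zero_X_mul]
    | succ n =>
      rw [h1, PowerSeries.coeff_succ_X_mul]
      simp only [map_add, PowerSeries.coeff_C_mul]
      rw [PowerSeries.coeff_C, PowerSeries.coeff_mul]

theorem a_mul_eq_iff (Q D : Ser) : a * D = Q - setA Q ↔ ∀ n, X * PowerSeries.coeff n D =
    PowerSeries.coeff n Q - C.comp (evalRingHom 0) (PowerSeries.coeff n Q) := by
  rw [PowerSeries.ext_iff]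
  simp only [a, setA, PowerSeries.coeff_C_mul, map_sub, PowerSeries.coeff_map]

theorem x_mul_eq_iff (Q E : Ser) : x * E = Q - setX Q ↔ ∀ n, C X * PowerSeries.coeff n E =
    PowerSeries.coeff n Q -
      mapRingHom (C.comp (evalRingHom 0)) (PowerSeries.coeff n Q) := by
  rw [PowerSeries.ext_iff]
  simp only [x, setX, PowerSeries.coeff_C_mul, map_sub, PowerSeries.coeff_map]

theorem functionalEquation_mk_coeffQ : FunctionalEquation (PowerSeries.mk coeffQ) := by
  refine ⟨PowerSeries.mk coeffD, PowerSeries.mk coeffE, (a_mul_eq_iff _ _).2 fun n => ?_,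
    (x_mul_eq_iff _ _).2 fun n => ?_, (functionalEquation_rhs_iff _ _ _).2 ⟨?_, fun n => ?_⟩⟩
  · simp only [PowerSeries.coeff_mk, X_mul_coeffD]
  · simp only [PowerSeries.coeff_mk, C_X_mul_coeffE]
  · rw [PowerSeries.coeff_mk, coeffQ_zero]
  · simp only [PowerSeries.coeff_mk]
    rcases eq_or_ne n 0 with rfl | hn
    · simp [coeffQ_one, coeffD_zero, coeffQ_zero]
    · rw [if_neg hn, zero_add, coeffQ_succ hn]

/-- The coefficient of t^(n+1) in Q involves only coefficients of Q, D, E up to n, and those of D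
and E are determined by those of Q on cancelling a and x. -/
theorem FunctionalEquation.unique {Q Q' : Ser} (h : FunctionalEquation Q)
    (h' : FunctionalEquation Q') : Q = Q' := by
  obtain ⟨D, E, hD, hE, hQ⟩ := h
  obtain ⟨D', E', hD', hE', hQ'⟩ := h'
  rw [a_mul_eq_iff] at hD hD'
  rw [x_mul_eq_iff] at hE hE'
  rw [functionalEquation_rhs_iff] at hQ hQ'
  have key : ∀ n, PowerSeries.coeff n Q = PowerSeries.coeff n Q' := by
    intro n
    induction n using Nat.strong_induction_on with
    | _ n ih =>
      cases n with
      | zero => rw [hQ.1, hQ'.1]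
      | succ n =>
        have eD : ∀ m ≤ n, PowerSeries.coeff m D = PowerSeries.coeff m D' := fun m hm =>
          mul_left_cancel₀ (X_ne_zero (R := ℤ[X]))
            (by rw [hD, hD', ih m (Nat.lt_succ_of_le hm)])
        have eE : ∀ m ≤ n, PowerSeries.coeff m E = PowerSeries.coeff m E' := fun m hm =>
          mul_left_cancel₀ (C_ne_zero.2 (X_ne_zero (R := ℤ)))
            (by rw [hE, hE', ih m (Nat.lt_succ_of_le hm)])
        rw [hQ.2, hQ'.2, eD n le_rfl, ih n (Nat.lt_succ_self n)]
        congr 4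
        refine Finset.sum_congr rfl fun p hp => ?_
        rw [eD _ (Finset.HasAntidiagonal.antidiagonal.fst_le hp),
          eE _ (Finset.HasAntidiagonal.antidiagonal.snd_le hp)]
  exact PowerSeries.ext key

/-! ### Back to 3-stack-sortable permutations. -/

/-- The permutations p are grouped by s(p), which ranges over 2-stack-sortable words. The case n = 0
is excluded because `twoSortable` omits the empty word. -/
theorem ncard_sortable_three {n : ℕ} (hn : n ≠ 0) :
    (sortable 3 n).ncard = ∑ w ∈ twoSortable n, fertility w := by
  classical
  have e : sortable 3 n = ((twoSortable n).biUnion preimages : Finset (List ℕ)) := by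
    ext p
    simp only [sortable, Set.mem_ofPred_eq, Finset.coe_biUnion, Set.mem_iUnion, Finset.mem_coe,
      mem_preimages, exists_prop, exists_eq_right', mem_twoSortable, Function.iterate_succ,
      Function.iterate_zero, Function.comp_apply, id_eq]
    rw [List.Perm.congr_left (stackSort_perm p)]
    refine and_congr_right fun hp => (and_iff_left ?_).symm
    intro h0
    have h1 := (stackSort_perm p).length_eq.trans hp.length_eq
    rw [h0, List.length_range'] at h1
    exact hn h1.symm
  rw [e, Set.ncard_coe_finset, Finset.card_biUnion]
  · rfl
  · intro v _ w _ hvw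
    refine Finset.disjoint_left.2 fun p hv hw => hvw ?_
    rw [← mem_preimages.1 hv, ← mem_preimages.1 hw]

theorem W_eq_setBoth_mk_coeffQ : W = setBoth (PowerSeries.mk coeffQ) := by
  ext n
  rw [W, setBoth, PowerSeries.coeff_mk, PowerSeries.coeff_map, PowerSeries.coeff_mk]
  rcases eq_or_ne n 0 with rfl | hn
  · rw [if_pos rfl, coeffQ_zero, map_zero]
  · rw [if_neg hn, ncard_sortable_three hn, coeffQ, map_sum, Nat.cast_sum]
    refine Finset.sum_congr rfl fun w hw => ?_
    simp [eval_zero_cutPolyA (mem_twoSortable.1 hw).2.2]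

end StackSorting

theorem mainTheorem1 :
    (∃! Q : StackSorting.Ser, StackSorting.FunctionalEquation Q) ∧
      ∀ Q : StackSorting.Ser, StackSorting.FunctionalEquation Q →
        StackSorting.W = StackSorting.setBoth Q :=
  ⟨⟨_, StackSorting.functionalEquation_mk_coeffQ,
    fun _ h => h.unique StackSorting.functionalEquation_mk_coeffQ⟩,
    fun _ h => h.unique StackSorting.functionalEquation_mk_coeffQ ▸
      StackSorting.W_eq_setBoth_mk_coeffQ⟩
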